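/- **Setting.** Let $d\ge 1$ and let $F:\mathbb R^d\to\mathbb R$ be differentiable with $\|\nabla F(w)-\nabla F(w')\|_2\le L\|w-w'\|_2$ and $F(w')\ge F(w)+\nabla F(w)^T(w'-w)+\frac m2\|w'-w\|_2^2$ for all $w,w'$, where $L,m>0$; let $w_*$ be the minimizer of $F$. Put $M(w)=\mathrm{diag}(\partial_1F(w)^2,\dots,\partial_dF(w)^2)$ and $S(w)=\mathrm{Tr}\,M(w)=\|\nabla F(w)\|_2^2$. *Oracles.* A stochastic gradient at $w$ of fidelity $\theta>0$ is $\nabla F(w)+U$, where $U$ has mean zero, covariance $\theta^{-1}M(w)$, and $i$-th coordinate sub-Gaussian with parameter $\theta^{-1}M(w)_{ii}$. On iteration $k$ there are a strictly increasing cost function $C$ on $(0,\infty)$ with $C(0^+)=c_{\min}\ge0$, an increasing aggregation cost $D$ with $D(1)=0$, a budget $B>0$, and $N=\max\{n\ge1: B>nc_{\min}+D(n)\}$; these may depend on $k$. For $1\le n\le N$ the mini-batch oracle of size $n$ returns the average of $n$ independent stochastic gradients of fidelity $\theta_n=C^{-1}((B-D(n))/n)$ (assumed to exist). Put $\sigma_n^2=1/(n\theta_n)$,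 $\sigma_{*}^2=\sigma_{n_*}^2=\min_{n\le N}\sigma_n^2$, $\Delta_n=\sigma_n^2-\sigma_*^2$, with a further subscript $k$ for the iteration where needed. All noise of iteration $k$ is independent of the past. *Algorithms.* Both algorithms start at the same square-integrable initial iterate and use deterministic step sizes $\eta_k>0$ and $T\ge1$ rounds per iteration. The optimal mini-batch SGD sets $w^o_{k+1}=w^o_k-\eta_kG^o$, where $G^o$ is the average of $T$ independent outputs of the oracle of size $n_*$ at $w_k^o$. EE-Grad sets $w_{k+1}=w_k-\eta_kG$, where $G$ is the average of the $T$ oracle outputs at $w_k$ obtained as follows: each size $n\le N$ is queried exactly twice in the first $2N$ rounds, and in each round $t=2N+1,\dots,T$ a size is queried that minimizes $V_t(n)-f\big(\alpha\ln t/(\gamma_t(n)-1)\big)$, where $\gamma_t(n)$ is the number of earlier queries of size $n$, $V_t(n)$ is the trace of the sample covariance matrix of their outputs, $\alpha>2$, $f(x)=\beta P\sqrt{xd/c}\,\max(1,\sqrt{x/(cd)})$, and $\beta=\beta_k$, $P=P_k$ are constants with $\sigma_n^2\le\beta$ for $n\le N$. Put $\phi(\varepsilon)=\frac{c\varepsilon}{\beta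 P}\min\big(1,\frac{\varepsilon/d}{\beta P}\big)$, $$C_{1,k}(w)=\sum_{n:\Delta_n>0}\frac{\alpha\Delta_n}{\phi(\Delta_nS(w)/2)},\qquad C_{2,k}=\Big(\sum_{n=1}^N\Delta_n\Big)\frac{2(\alpha-1)}{\alpha-2},\qquad Z_{T,k}(w)=\frac{\sigma_{*,k}^2}{T}+O_{T,k}(w),$$ $$O_{T,k}(w)=\frac{C_{1,k}(w)\ln T}{T^2}+\frac{C_{2,k}}{T^2}$$ (terms with denominator $0$ are read as $0$). Let $J_k=\mathbb E F(w_k)-F(w_*)$, $J^o_k=\mathbb E F(w^o_k)-F(w_*)$, and $$\tau^o_k=mL\eta_k^2\Big(1+\frac{\sigma_{*,k}^2}{T}\Big)-2m\eta_k+1,\qquad \tau_k(w)=\tau^o_k+mL\eta_k^2\,O_{T,k}(w).$$ **Theorem.** There is a universal constant $c>0$ such that, in this setting with this $c$, the expectations in $J_k,J_k^o$ are finite and the following holds for every iteration $k$. 1. For every $w$: $O_{T,k}(w)\ge0$, with strict inequality if some $\Delta_{n}>0$, and $O_{T,k}(w)\to0$ as $T\to\infty$. 2. If $0<\eta_k<\frac{2}{L(1+Z_{T,k}(w))}$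 for at least one $w$, then $0<\tau_k^o<1$, almost surely $\mathbb E[F(w^o_{k+1})\mid\text{past}]-F(w_*)\le\tau_k^o\,(F(w_k^o)-F(w_*))$, and hence $J^o_{k+1}\le\tau^o_kJ^o_k$. 3. Almost surely, if $S(w_k)\le P_k$ and $0<\eta_k<\frac{2}{L(1+Z_{T,k}(w_k))}$, then $0<\tau_k(w_k)<1$ and $\mathbb E[F(w_{k+1})\mid\text{past}]-F(w_*)\le\tau_k(w_k)\,(F(w_k)-F(w_*))$. 4. If $S(w_k)\le P_k$ and $0<\eta_k<\frac{2}{L(1+Z_{T,k}(w_k))}$ hold almost surely, then $J_{k+1}\le\mathbb E[\tau_k(w_k)(F(w_k)-F(w_*))]$, and $J_{k+1}\le\tau\,J_k$ for every constant $\tau$ with $\tau_k(w_k)\le\tau$ almost surely; in particular $J_{k+1}\le\tau_kJ_k$ whenever $\tau_k=\tau_k(w_k)$ is deterministic. -/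

import Mathlib

open MeasureTheory ProbabilityTheory Filter Topology

namespace EEGrad

/-- The parameter space `ℝ^d` with its Euclidean norm. -/
abbrev Vec (d : ℕ) : Type := EuclideanSpace ℝ (Fin d)

/-! ### Cost-fidelity model and mini-batch oracles -/

/-- The cost model of one SGD iteration: the cost `cost θ` of a stochastic gradient of fidelity
`θ > 0`, its limit `cmin` at `0`, the aggregation cost `aggr n` of a mini-batch of size `n ≥ 1`,
the per-round budget, and the largest feasible mini-batch size `N`. -/
structure OracleModel where
  cost : ℝ → ℝ
  cmin : ℝ
  aggr : ℕ → ℝ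
  budget : ℝ
  N : ℕ
  cost_strictMono : StrictMonoOn cost (Set.Ioi 0)
  cost_tendsto : Tendsto cost (𝓝[>] 0) (𝓝 cmin)
  cmin_nonneg : 0 ≤ cmin
  aggr_mono : MonotoneOn aggr (Set.Ici 1)
  aggr_one : aggr 1 = 0
  budget_pos : 0 < budget
  isGreatest_N : IsGreatest {n : ℕ | 1 ≤ n ∧ (n : ℝ) * cmin + aggr n < budget} N
  /-- The share `(budget - aggr n) / n` of each gradient in a feasible mini-batch is the cost of
  some fidelity, that is, the inverse of `cost` is defined there. -/
  attained : ∀ n ∈ Finset.Icc 1 N, (budget - aggr n) / n ∈ cost '' Set.Ioi 0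

namespace OracleModel

/-- The fidelity `θ_n`, the inverse of `cost` at `(budget - aggr n) / n`. -/
noncomputable def fidelity (O : OracleModel) (n : ℕ) : ℝ :=
  Function.invFunOn O.cost (Set.Ioi 0) ((O.budget - O.aggr n) / n)

/-- `σ_n² = 1 / (n θ_n)`. -/
noncomputable def sigmaSq (O : OracleModel) (n : ℕ) : ℝ := 1 / (n * O.fidelity n)

/-- `n` is an optimal mini-batch size: it minimizes `σ_n²` over `1, …, N`. -/
def IsOptimal (O : OracleModel) (n : ℕ) : Prop :=
  n ∈ Finset.Icc 1 O.N ∧ ∀ n' ∈ Finset.Icc 1 O.N, O.sigmaSq n ≤ O.sigmaSq n'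

end OracleModel

/-- `M(w) = diag(∂₁F(w)², …, ∂_dF(w)²)`. -/
noncomputable def covShape {d : ℕ} (F : Vec d → ℝ) (w : Vec d) : Matrix (Fin d) (Fin d) ℝ :=
  Matrix.diagonal fun i => (gradient F w i) ^ 2

/-- `S(w) = Tr M(w)`. -/
noncomputable def noiseTrace {d : ℕ} (F : Vec d → ℝ) (w : Vec d) : ℝ := (covShape F w).trace

/-- `U θ w` is, as a random vector on the seed space `(Ξ, ν)`, a perturbation at `w` of fidelity
`θ`: it has mean zero and covariance matrix `θ⁻¹ M(w)`, and its `i`-th coordinate is sub-Gaussian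
with parameter `θ⁻¹ M(w)_{ii}`. -/
structure IsNoise {d : ℕ} {Ξ : Type*} [MeasurableSpace Ξ] (F : Vec d → ℝ)
    (U : ℝ → Vec d → Ξ → Vec d) (ν : Measure Ξ) : Prop where
  measurable : ∀ θ : ℝ, 0 < θ → Measurable fun p : Vec d × Ξ => U θ p.1 p.2
  mean_zero : ∀ θ : ℝ, 0 < θ → ∀ w, ∫ x, U θ w x ∂ν = 0
  cov : ∀ θ : ℝ, 0 < θ → ∀ w, ∀ i j, ∫ x, U θ w x i * U θ w x j ∂ν = θ⁻¹ * covShape F w i j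
  subgaussian : ∀ θ : ℝ, 0 < θ → ∀ w, ∀ i,
    HasSubgaussianMGF (fun x => U θ w x i) (θ⁻¹ * covShape F w i i).toNNReal ν

/-- A mini-batch gradient at `w`: the average of the `n` stochastic gradients
`∇F(w) + U_j(w, θ)`, where `U_j` is computed from the seed `s j`. -/
noncomputable def miniBatch {d : ℕ} {Ξ : Type*} (F : Vec d → ℝ) (U : ℝ → Vec d → Ξ → Vec d)
    (θ : ℝ) (n : ℕ) (w : Vec d) (s : ℕ → Ξ) : Vec d :=
  (n : ℝ)⁻¹ • ∑ j ∈ Finset.range n, (gradient F w + U θ w (s j))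

/-! ### The EE-Grad procedure of one SGD iteration -/

/-- The past rounds of one iteration in chronological order: which mini-batch size was queried,
and the gradient that the oracle returned. -/
abbrev History (d : ℕ) : Type := List (ℕ × Vec d)

/-- The outputs of the mini-batch oracle of size `n` so far. -/
def outputs {d : ℕ} (h : History d) (n : ℕ) : List (Vec d) :=
  (h.filter fun p => p.1 = n).map Prod.snd

/-- `γ(n)`, the number of past rounds in which the mini-batch oracle of size `n` was queried. -/
def pulls {d : ℕ} (h : History d) (n : ℕ) : ℕ := (outputs h n).length

/-- Sample mean. -/
noncomputable def sampleMean {d : ℕ} (l : List (Vec d)) : Vec d := (l.length : ℝ)⁻¹ • l.sum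

/-- Sample covariance matrix. -/
noncomputable def sampleCov {d : ℕ} (l : List (Vec d)) : Matrix (Fin d) (Fin d) ℝ :=
  ((l.length : ℝ) - 1)⁻¹ •
    (l.map fun x => Matrix.vecMulVec ⇑(x - sampleMean l) ⇑(x - sampleMean l)).sum

/-- The function `f` of the selection rule. -/
noncomputable def bonus (c : ℝ) (d : ℕ) (β P x : ℝ) : ℝ :=
  β * P * √(x * d / c) * max 1 √(x / (c * d))

/-- The function `φ`. -/
noncomputable def rate (c : ℝ) (d : ℕ) (β P ε : ℝ) : ℝ :=
  c * ε / (β * P) * min 1 (ε / d / (β * P))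

/-- The index `V_t(n) - f(α ln t / (γ_t(n) - 1))` of the mini-batch size `n` in the round
`t = h.length + 1` that follows the history `h`; `V_t(n)` is the trace of the sample covariance. -/
noncomputable def score {d : ℕ} (c α β P : ℝ) (h : History d) (n : ℕ) : ℝ :=
  (sampleCov (outputs h n)).trace -
    bonus c d β P (α * Real.log ((h.length : ℝ) + 1) / ((pulls h n : ℝ) - 1))

/-- `π`, which maps the history to the mini-batch size of the next round, follows the EE-Grad
strategy: in the first `2N` rounds it runs through a schedule in which each size occurs exactly
twice, and afterwards it picks a minimizer of the index (ties are broken in any way). -/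
structure IsEEGradPolicy {d : ℕ} (c α β P : ℝ) (N : ℕ) (π : History d → ℕ) : Prop where
  measurable : ∀ t : ℕ, Measurable fun h : Fin t → ℕ × Vec d => π (List.ofFn h)
  mem : ∀ h, π h ∈ Finset.Icc 1 N
  init : ∃ schedule : ℕ → ℕ,
    (∀ h : History d, h.length < 2 * N → π h = schedule h.length) ∧
    ∀ n ∈ Finset.Icc 1 N, ((Finset.range (2 * N)).filter fun t => schedule t = n).card = 2
  select : ∀ h : History d, 2 * N ≤ h.length → (∀ n ∈ Finset.Icc 1 N, 2 ≤ pulls h n) →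
    ∀ n ∈ Finset.Icc 1 N, score c α β P h (π h) ≤ score c α β P h n

/-- The history after `t` rounds, when the `i`-th query (from `i = 0`) of the mini-batch oracle of
size `n` returns `X n i`. -/
def historyAfter {d : ℕ} (π : History d → ℕ) (X : ℕ → ℕ → Vec d) : ℕ → History d
  | 0 => []
  | t + 1 =>
    let h := historyAfter π X t
    h ++ [(π h, X (π h) (pulls h (π h)))]

/-- The stochastic gradient computed by EE-Grad: the average of the outputs of `T` rounds. -/
noncomputable def eeGradient {d : ℕ} (π : History d → ℕ) (X : ℕ → ℕ → Vec d) (T : ℕ) : Vec d :=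
  (T : ℝ)⁻¹ • ((historyAfter π X T).map Prod.snd).sum

/-! ### The two SGD algorithms -/

/-- The data of an SGD run; `k : ℕ` numbers the iterations, starting from `0`.
* `F`: objective function, `T`: number of rounds per iteration, `η k`: step sizes;
* `oracle k`: the cost model of iteration `k`, `nStar k`: an optimal mini-batch size;
* `U k θ w`: the perturbation of a stochastic gradient, as a function of a random seed in `Ξ`;
* `seed k (n, i, j)`: the seed of the `j`-th gradient in the `i`-th output of the mini-batch oracle
  of size `n` on iteration `k`;
* `α`, `β k`, `P k`, `π k`: the parameters of EE-Grad and its strategy on iteration `k`;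
* `w₀`: the initial iterate, possibly random. -/
structure Run (d : ℕ) (Ω Ξ : Type*) where
  F : Vec d → ℝ
  T : ℕ
  η : ℕ → ℝ
  oracle : ℕ → OracleModel
  nStar : ℕ → ℕ
  U : ℕ → ℝ → Vec d → Ξ → Vec d
  seed : ℕ → ℕ × ℕ × ℕ → Ω → Ξ
  α : ℝ
  β : ℕ → ℝ
  P : ℕ → ℝ
  π : ℕ → History d → ℕ
  w₀ : Ω → Vec d

namespace Run

variable {d : ℕ} {Ω Ξ : Type*} (R : Run d Ω Ξ)

/-- The `i`-th output at `w` of the mini-batch oracle of size `n` on iteration `k`. -/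
noncomputable def oracleOutput (k : ℕ) (ω : Ω) (w : Vec d) (n i : ℕ) : Vec d :=
  miniBatch R.F (R.U k) ((R.oracle k).fidelity n) n w fun j => R.seed k (n, i, j) ω

/-- The iterates `w_k` of SGD with EE-Grad. -/
noncomputable def iter : ℕ → Ω → Vec d
  | 0, ω => R.w₀ ω
  | k + 1, ω => iter k ω - R.η k • eeGradient (R.π k) (R.oracleOutput k ω (iter k ω)) R.T

/-- The iterates `wᵒ_k` of the optimal mini-batch SGD algorithm, which queries the optimal
mini-batch oracle in each of the `T` rounds. -/
noncomputable def optIter : ℕ → Ω → Vec d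
  | 0, ω => R.w₀ ω
  | k + 1, ω => optIter k ω - R.η k •
      ((R.T : ℝ)⁻¹ • ∑ t ∈ Finset.range R.T, R.oracleOutput k ω (optIter k ω) (R.nStar k) t)

/-- `σ_*²` on iteration `k`. -/
noncomputable def sigmaStarSq (k : ℕ) : ℝ := (R.oracle k).sigmaSq (R.nStar k)

/-- `Δ_n = σ_n² - σ_*²` on iteration `k`. -/
noncomputable def Δ (k n : ℕ) : ℝ := (R.oracle k).sigmaSq n - R.sigmaStarSq k

/-- `C₁(w)` on iteration `k`. -/
noncomputable def C₁ (c : ℝ) (k : ℕ) (w : Vec d) : ℝ :=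
  ∑ n ∈ (Finset.Icc 1 (R.oracle k).N).filter fun n => 0 < R.Δ k n,
    R.α * R.Δ k n / rate c d (R.β k) (R.P k) (R.Δ k n * noiseTrace R.F w / 2)

/-- `C₂` on iteration `k`. -/
noncomputable def C₂ (k : ℕ) : ℝ :=
  (∑ n ∈ Finset.Icc 1 (R.oracle k).N, R.Δ k n) * (2 * (R.α - 1) / (R.α - 2))

/-- `Z_T(w)` on iteration `k`. -/
noncomputable def Z (c : ℝ) (T k : ℕ) (w : Vec d) : ℝ :=
  R.sigmaStarSq k / T + Real.log T / (T : ℝ) ^ 2 * R.C₁ c k w + 1 / (T : ℝ) ^ 2 * R.C₂ k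

/-- `O_{T,k} = Z_T(w) - σ_*² / T`. -/
noncomputable def excess (c : ℝ) (T k : ℕ) (w : Vec d) : ℝ :=
  R.Z c T k w - R.sigmaStarSq k / T

/-- The contraction factor `τᵒ_k(η_k)` of the optimal mini-batch SGD algorithm. -/
noncomputable def τopt (m L : ℝ) (k : ℕ) : ℝ :=
  m * L * R.η k ^ 2 * (1 + R.sigmaStarSq k / R.T) - 2 * m * R.η k + 1

/-- The contraction factor `τ_k(η_k)` of EE-Grad at `w_k = w`. -/
noncomputable def τ (c m L : ℝ) (k : ℕ) (w : Vec d) : ℝ :=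
  R.τopt m L k + m * L * R.η k ^ 2 * R.excess c R.T k w

variable [MeasurableSpace Ω]

/-- The expected gap `J_k` of EE-Grad with respect to `wstar`. -/
noncomputable def J (μ : Measure Ω) (wstar : Vec d) (k : ℕ) : ℝ :=
  (∫ ω, R.F (R.iter k ω) ∂μ) - R.F wstar

/-- The expected gap `Jᵒ_k` of the optimal mini-batch SGD algorithm with respect to `wstar`. -/
noncomputable def Jopt (μ : Measure Ω) (wstar : Vec d) (k : ℕ) : ℝ :=
  (∫ ω, R.F (R.optIter k ω) ∂μ) - R.F wstar

/-- The standing assumptions on an SGD run with EE-Grad (with the constant `c` in its selection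
rule). The filtration `ℱ` describes the past: `ℱ k` is what is known when iteration `k` starts. -/
structure Admissible [MeasurableSpace Ξ] (c : ℝ) (μ : Measure Ω) (ν : Measure Ξ)
    (ℱ : Filtration ℕ (inferInstance : MeasurableSpace Ω)) : Prop where
  T_pos : 0 < R.T
  two_lt_α : 2 < R.α
  isOptimal : ∀ k, (R.oracle k).IsOptimal (R.nStar k)
  le_β : ∀ k, ∀ n ∈ Finset.Icc 1 (R.oracle k).N, (R.oracle k).sigmaSq n ≤ R.β k
  policy : ∀ k, IsEEGradPolicy c R.α (R.β k) (R.P k) (R.oracle k).N (R.π k)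
  noise : ∀ k, IsNoise R.F (R.U k) ν
  /-- The initial iterate is known at the start and square integrable. -/
  measurable_w₀ : Measurable[ℱ 0] R.w₀
  memLp_w₀ : MemLp R.w₀ 2 μ
  /-- The seeds of an iteration are independent, with law `ν`, and independent of the past. -/
  measurable_seed : ∀ k i, Measurable[ℱ (k + 1)] (R.seed k i)
  seed_law : ∀ k i, μ.map (R.seed k i) = ν
  seed_iIndep : ∀ k, iIndepFun (R.seed k) μ
  seed_indep_past : ∀ k,
    Indep (MeasurableSpace.comap (fun ω i => R.seed k i ω) MeasurableSpace.pi) (ℱ k) μ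

end Run

end EEGrad

open EEGrad

/-!
# Contraction of SGD with EE-Grad

**One step.** For a function with `L`-Lipschitz gradient, the quadratic upper model bounds the
expected value of `F` after one step by the mean and the second moment of the stochastic gradient.
If the mean is `∇F(w)` and the second moment is at most `(1 + z) ‖∇F(w)‖²`, then the step size
condition and the Polyak–Łojasiewicz inequality, which follows from strong convexity, turn this into
a contraction of the gap by `m L η² (1 + z) - 2 m η + 1` (`expected_descent`). So everything rests
on the second moment, with `z = σ_*² / T` for the optimal mini-batch size and `z = Z_T(w)` for EE-Grad.

**Adaptive sampling.** The outputs of the oracles at a fixed point form a table with independent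
entries. The entry `(n, i)` is independent of the event that it is revealed in a given round, and of
what has been revealed before, since until then the course of the procedure is determined by the
other entries (`measurable_reveals`). So the noise terms of the `T` rounds have mean zero and are
uncorrelated, and the gradient is unbiased with variance `S / T² * ∑ n, σ_n² E[γ(n)]`, where `γ(n)`
counts the queries of size `n` (`IsSubGaussianTable.moments_eeGradient`). As the counts add up to
`T`, this is `S σ_*² / T` plus `S / T² * ∑ n, Δ_n E[γ(n)]`. The optimal algorithm is the case of a
constant strategy.

**Counting suboptimal queries.** As for the UCB strategy in the bandit problem, a suboptimal size is
queried again only if its width `f` is still large, which happens for at most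
`1 + α ln T / φ(Δ_n S / 2)` queries, or if a sample variance misses its confidence bound. The latter
has probability `O(t^{1-α})` in round `t`, which is summable as `α > 2`; the initial rounds and this
sum make up `2 (α - 1) / (α - 2)` (`IsSubGaussianTable.integral_count_le`).

**Concentration of the sample variance.** The square of a sub-Gaussian variable has an exponential
moment, as one sees by integrating its moment generating function against a Gaussian. By convexity
of `exp`, this carries over to the squared norm of a vector with sub-Gaussian coordinates, however
the coordinates depend on each other. Hence normalized squares are sub-exponential, and so is the
sample variance, the difference of a sum of independent squares and one more square
(`IsRow.mgf_sampleVar_le`). The constants are absolute, which provides the universal constant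
`selC`.

**Conditioning.** The iterate is known at the start of an iteration and the seeds are independent of
the past, so the conditional expectation is computed with the iterate held fixed
(`condExp_comp_prodMk_of_indep`). Iterates stay square integrable because the gradient grows at most
linearly.
-/

namespace EEGrad

/-! ### The course of one run of the sampling procedure -/

section Procedure

variable {d : ℕ} (π : History d → ℕ) (X X' : ℕ → ℕ → Vec d)

/-- The mini-batch size queried in round `t`, counting rounds from `0`. -/
def query (t : ℕ) : ℕ := π (historyAfter π X t)

/-- The number of queries of the mini-batch size `n` before round `t`. -/
def count (t n : ℕ) : ℕ := pulls (historyAfter π X t) n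

/-- The gradient returned in round `t`. -/
def answer (t : ℕ) : Vec d := X (query π X t) (count π X t (query π X t))

theorem historyAfter_succ (t : ℕ) :
    historyAfter π X (t + 1) = historyAfter π X t ++ [(query π X t, answer π X t)] := rfl

theorem length_historyAfter (t : ℕ) : (historyAfter π X t).length = t := by
  induction t with
  | zero => rfl
  | succ t ih => rw [historyAfter_succ, List.length_append, ih]; rfl

theorem historyAfter_eq_ofFn (t : ℕ) :
    historyAfter π X t = List.ofFn fun j : Fin t => (query π X j, answer π X j) := by
  induction t with
  | zero => simp [historyAfter]
  | succ t ih => rw [historyAfter_succ, ih, List.ofFn_succ', List.concat_eq_append]; simp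

theorem outputs_append_singleton (h : History d) (p : ℕ × Vec d) (n : ℕ) :
    outputs (h ++ [p]) n = outputs h n ++ if p.1 = n then [p.2] else [] := by
  by_cases hp : p.1 = n <;> simp [outputs, hp, List.filter_append]

theorem count_zero (n : ℕ) : count π X 0 n = 0 := rfl

theorem count_succ (t n : ℕ) :
    count π X (t + 1) n = count π X t n + if query π X t = n then 1 else 0 := by
  unfold count pulls
  rw [historyAfter_succ, outputs_append_singleton]
  by_cases h : query π X t = n <;> simp [h]

theorem count_eq_sum (t n : ℕ) :
    count π X t n = ∑ j ∈ Finset.range t, if query π X j = n then 1 else 0 := by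
  induction t with
  | zero => rfl
  | succ t ih => rw [count_succ, ih, Finset.sum_range_succ]

theorem count_mono (n : ℕ) : Monotone fun t => count π X t n :=
  monotone_nat_of_le_succ fun t => by rw [count_succ]; exact Nat.le_add_right _ _

theorem count_le (t n : ℕ) : count π X t n ≤ t := by
  induction t with
  | zero => rfl
  | succ t ih => rw [count_succ]; split_ifs <;> omega

/-- The outputs of an oracle are revealed in the order in which the table lists them. -/
theorem outputs_historyAfter (t n : ℕ) :
    outputs (historyAfter π X t) n = (List.range (count π X t n)).map (X n) := by
  induction t with
  | zero => rfl
  | succ t ih =>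
    rw [count_succ, historyAfter_succ, outputs_append_singleton, ih]
    by_cases h : query π X t = n
    · simp only [h, if_true, List.range_succ, List.map_append, answer]
      rfl
    · simp [h]

/-- The history depends only on the table entries that it has revealed. -/
theorem historyAfter_congr {t : ℕ}
    (h : ∀ j < t, X (query π X j) (count π X j (query π X j))
      = X' (query π X j) (count π X j (query π X j))) :
    historyAfter π X t = historyAfter π X' t := by
  induction t with
  | zero => rfl
  | succ t ih =>
    have ih' := ih fun j hj => h j (hj.trans t.lt_succ_self)
    have hq : query π X t = query π X' t := by unfold query; rw [ih']
    have hc : ∀ n, count π X t n = count π X' t n := fun n => by unfold count; rw [ih']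
    have ha : answer π X t = answer π X' t := by
      unfold answer
      rw [h t t.lt_succ_self, hq, hc]
    rw [historyAfter_succ, historyAfter_succ, ih', hq, ha]

/-- Changing a table entry that has not been revealed does not change the history. -/
theorem historyAfter_congr_of_count_le {t n i : ℕ} (hi : count π X t n ≤ i)
    (h : ∀ n' i', (n', i') ≠ (n, i) → X n' i' = X' n' i') :
    historyAfter π X t = historyAfter π X' t := by
  refine historyAfter_congr π X X' fun j hj => h _ _ fun he => ?_
  have h1 : query π X j = n := congrArg Prod.fst he
  have h2 : count π X j (query π X j) = i := congrArg Prod.snd he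
  rw [h1] at h2
  have h3 := count_succ π X j n
  rw [if_pos h1, h2] at h3
  have h4 : count π X (j + 1) n ≤ count π X t n := count_mono π X n hj
  omega

theorem sum_historyAfter (t : ℕ) :
    ((historyAfter π X t).map Prod.snd).sum = ∑ j ∈ Finset.range t, answer π X j := by
  induction t with
  | zero => simp [historyAfter]
  | succ t ih =>
    rw [historyAfter_succ, List.map_append, List.sum_append, ih, Finset.sum_range_succ]
    simp

theorem eeGradient_eq (T : ℕ) :
    eeGradient π X T = (T : ℝ)⁻¹ • ∑ j ∈ Finset.range T, answer π X j := by
  rw [eeGradient, sum_historyAfter]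

theorem count_const (n t : ℕ) : count (fun _ => n) X t n = t := by
  induction t with
  | zero => rfl
  | succ t ih => rw [count_succ, ih]; simp [query]

theorem answer_const (n t : ℕ) : answer (fun _ => n) X t = X n t := by
  unfold answer
  change X n (count (fun _ => n) X t n) = X n t
  rw [count_const]

end Procedure

section Policy

variable {d : ℕ} {c α β P : ℝ} {N : ℕ} {π : History d → ℕ}

theorem IsEEGradPolicy.count_init (hπ : IsEEGradPolicy c α β P N π) (X : ℕ → ℕ → Vec d) {n : ℕ}
    (hn : n ∈ Finset.Icc 1 N) : count π X (2 * N) n = 2 := by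
  obtain ⟨s, hs, hc⟩ := hπ.init
  rw [count_eq_sum]
  refine Eq.trans ?_ ((Finset.card_filter _ _).symm.trans (hc n hn))
  refine Finset.sum_congr rfl fun j hj => ?_
  have : query π X j = s j := by
    have := hs (historyAfter π X j)
    rw [length_historyAfter] at this
    exact this (Finset.mem_range.1 hj)
  rw [this]

theorem IsEEGradPolicy.two_le_count (hπ : IsEEGradPolicy c α β P N π) (X : ℕ → ℕ → Vec d) {n t : ℕ}
    (hn : n ∈ Finset.Icc 1 N) (ht : 2 * N ≤ t) : 2 ≤ count π X t n :=
  (hπ.count_init X hn).symm.le.trans (count_mono π X n ht)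

theorem IsEEGradPolicy.count_le_two (hπ : IsEEGradPolicy c α β P N π) (X : ℕ → ℕ → Vec d) {n t : ℕ}
    (hn : n ∈ Finset.Icc 1 N) (ht : t ≤ 2 * N) : count π X t n ≤ 2 :=
  (count_mono π X n ht).trans (hπ.count_init X hn).le

/-- The trace of the sample covariance matrix of the first `s` outputs in a row of the table. -/
noncomputable def sampleVar (x : ℕ → Vec d) (s : ℕ) : ℝ :=
  (sampleCov ((List.range s).map x)).trace

theorem IsEEGradPolicy.index_le (hπ : IsEEGradPolicy c α β P N π) (X : ℕ → ℕ → Vec d) {n t : ℕ}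
    (hn : n ∈ Finset.Icc 1 N) (ht : 2 * N ≤ t) :
    sampleVar (X (query π X t)) (count π X t (query π X t))
        - bonus c d β P (α * Real.log ((t : ℝ) + 1) / ((count π X t (query π X t) : ℝ) - 1))
      ≤ sampleVar (X n) (count π X t n)
        - bonus c d β P (α * Real.log ((t : ℝ) + 1) / ((count π X t n : ℝ) - 1)) := by
  have := hπ.select (historyAfter π X t) (by rwa [length_historyAfter])
    (fun n hn => hπ.two_le_count X hn ht) n hn
  simp only [score, outputs_historyAfter, length_historyAfter] at this
  exact this

end Policy

/-! ### Measurability of the sampling procedure -/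

section Measurability

variable {d : ℕ} {Ω : Type*} [MeasurableSpace Ω] {π : History d → ℕ} {X : Ω → ℕ → ℕ → Vec d}

theorem measurable_query_answer
    (hπ : ∀ t : ℕ, Measurable fun h : Fin t → ℕ × Vec d => π (List.ofFn h))
    (hX : ∀ n i, Measurable fun ω => X ω n i) (t : ℕ) :
    Measurable (fun ω => query π (X ω) t) ∧ Measurable (fun ω => answer π (X ω) t) ∧
      ∀ n, Measurable fun ω => count π (X ω) t n := by
  induction t using Nat.strong_induction_on with
  | _ t ih =>
    have hc : ∀ n, Measurable fun ω => count π (X ω) t n := fun n => by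
      simp only [count_eq_sum]
      refine Finset.measurable_sum _ fun j hj => Measurable.ite ?_ measurable_const measurable_const
      exact (ih j (Finset.mem_range.1 hj)).1 (measurableSet_singleton n)
    have hq : Measurable fun ω => query π (X ω) t := by
      have h : (fun ω => query π (X ω) t) = (fun h : Fin t → ℕ × Vec d => π (List.ofFn h)) ∘
          fun ω (j : Fin t) => (query π (X ω) j, answer π (X ω) j) := by
        funext ω
        rw [Function.comp, ← historyAfter_eq_ofFn]
        rfl
      rw [h]
      exact (hπ t).comp (measurable_pi_lambda _ fun j => (ih j j.2).1.prodMk (ih j j.2).2.1)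
    refine ⟨hq, ?_, hc⟩
    have h1 : Measurable fun z : (ℕ × ℕ) × Ω => X z.2 z.1.1 z.1.2 :=
      measurable_from_prod_countable_right fun z => hX z.1 z.2
    have h2 : Measurable fun z : ℕ × Ω => count π (X z.2) t z.1 :=
      measurable_from_prod_countable_right fun n => hc n
    exact h1.comp ((hq.prodMk (h2.comp (hq.prodMk measurable_id))).prodMk measurable_id)

end Measurability

/-! ### Moments of the gradient under adaptive sampling -/

section Moments

variable {d : ℕ} {Ω : Type*} {X : Ω → ℕ → ℕ → Vec d} {g : Vec d} {A : Finset ℕ}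
  {π : History d → ℕ}

/-- The σ-algebra generated by all table entries other than `(n, i)`. -/
abbrev others (X : Ω → ℕ → ℕ → Vec d) (n i : ℕ) : MeasurableSpace Ω :=
  ⨆ p ∈ ({(n, i)}ᶜ : Set (ℕ × ℕ)), MeasurableSpace.comap (fun ω => X ω p.1 p.2) inferInstance

/-- The event that the entry `(n, i)` of the table is the one revealed in round `t`. -/
def reveals (π : History d → ℕ) (X : Ω → ℕ → ℕ → Vec d) (t n i : ℕ) : Set Ω :=
  {ω | query π (X ω) t = n ∧ count π (X ω) t n = i}

/-- Until an entry of the table is revealed, the course of the procedure is determined by the other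
entries. -/
theorem measurable_reveals
    (hπ : ∀ t : ℕ, Measurable fun h : Fin t → ℕ × Vec d => π (List.ofFn h))
    (t n i : ℕ) :
    MeasurableSet[others X n i] (reveals π X t n i) ∧
    Measurable[others X n i] ((reveals π X t n i).indicator
      fun ω => ∑ j ∈ Finset.range t, (answer π (X ω) j - g)) := by
  -- the table in which the entry in question is replaced by `0`
  set X' : Ω → ℕ → ℕ → Vec d := fun ω n' i' => if (n', i') = (n, i) then 0 else X ω n' i' with hX'
  have hm : ∀ n' i', Measurable[others X n i] fun ω => X' ω n' i' := fun n' i' => by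
    by_cases hp : (n', i') = (n, i)
    · simp only [hX', hp, if_true]
      exact @measurable_const _ _ _ (others X n i) _
    · simp only [hX', hp, if_false]
      refine Measurable.mono (comap_measurable _) ?_ le_rfl
      exact le_iSup₂_of_le (f := fun (p : ℕ × ℕ) (_ : p ∈ ({(n, i)}ᶜ : Set (ℕ × ℕ))) =>
        MeasurableSpace.comap (fun ω => X ω p.1 p.2) inferInstance) (n', i') hp le_rfl
  have hqa := fun t => @measurable_query_answer d Ω (others X n i) π X' hπ hm t
  have hXX' : ∀ ω n' i', (n', i') ≠ (n, i) → X ω n' i' = X' ω n' i' := fun ω n' i' hp => by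
    simp only [hX', hp, if_false]
  have heq : reveals π X t n i = reveals π X' t n i := by
    ext ω
    constructor
    · rintro ⟨h1, h2⟩
      have := historyAfter_congr_of_count_le π (X ω) (X' ω) h2.le (hXX' ω)
      refine ⟨?_, ?_⟩
      · rw [← h1]; unfold query; rw [this]
      · rw [← h2]; unfold count; rw [this]
    · rintro ⟨h1, h2⟩
      have := historyAfter_congr_of_count_le π (X' ω) (X ω) h2.le
        (fun n' i' hp => (hXX' ω n' i' hp).symm)
      refine ⟨?_, ?_⟩
      · rw [← h1]; unfold query; rw [this]
      · rw [← h2]; unfold count; rw [this]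
  have hset : MeasurableSet[others X n i] (reveals π X t n i) := by
    rw [heq]
    exact ((hqa t).1 (measurableSet_singleton n)).inter
      ((hqa t).2.2 n (measurableSet_singleton i))
  refine ⟨hset, ?_⟩
  have heq2 : ((reveals π X t n i).indicator fun ω => ∑ j ∈ Finset.range t, (answer π (X ω) j - g))
      = (reveals π X t n i).indicator
        fun ω => ∑ j ∈ Finset.range t, (answer π (X' ω) j - g) := by
    refine Set.indicator_congr fun ω hω => ?_
    have := historyAfter_congr_of_count_le π (X ω) (X' ω) hω.2.le (hXX' ω)
    rw [Finset.sum_sub_distrib, Finset.sum_sub_distrib, ← sum_historyAfter, ← sum_historyAfter,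
      this]
  rw [heq2]
  refine Measurable.indicator ?_ hset
  exact Finset.measurable_sum _ fun j _ => ((hqa j).2.1).sub_const g

theorem answer_sub_eq_sum (hA : ∀ h, π h ∈ A) (X : Ω → ℕ → ℕ → Vec d) (t : ℕ) (ω : Ω)
    {M : Type*} [AddCommMonoid M] (f : Vec d → M) :
    f (answer π (X ω) t) = ∑ n ∈ A, ∑ i ∈ Finset.range (t + 1),
      (reveals π X t n i).indicator (fun ω => f (X ω n i)) ω := by
  rw [Finset.sum_eq_single_of_mem (query π (X ω) t) (hA _),
    Finset.sum_eq_single_of_mem (count π (X ω) t (query π (X ω) t))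
      (Finset.mem_range.2 (Nat.lt_succ_of_le (count_le _ _ _ _)))]
  · rw [Set.indicator_of_mem (show ω ∈ reveals π X t _ _ from ⟨rfl, rfl⟩)]; rfl
  · intro i _ hi
    exact Set.indicator_of_notMem (fun h => hi h.2.symm) _
  · intro n _ hn
    exact Finset.sum_eq_zero fun i _ => Set.indicator_of_notMem (fun h => hn h.1.symm) _

variable [MeasurableSpace Ω]

theorem integrable_inner_of_memLp {μ : Measure Ω} {f g : Ω → Vec d} (hf : MemLp f 2 μ)
    (hg : MemLp g 2 μ) : Integrable (fun ω => inner ℝ (f ω) (g ω)) μ :=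
  (hf.norm.integrable_mul hg.norm).mono (hf.1.inner hg.1)
    (ae_of_all _ fun ω => by simpa using abs_real_inner_le_norm (f ω) (g ω))

/-- A table of independent square-integrable random vectors `X n i` with mean `g`, in which the
deviation from `g` has second moment `v n` in every row `n ∈ A`. -/
structure IsTable (μ : Measure Ω) (X : Ω → ℕ → ℕ → Vec d) (g : Vec d) (A : Finset ℕ)
    (v : ℕ → ℝ) : Prop where
  measurable : ∀ n i, Measurable fun ω => X ω n i
  indep : iIndepFun (fun (p : ℕ × ℕ) ω => X ω p.1 p.2) μ
  memLp : ∀ n ∈ A, ∀ i, MemLp (fun ω => X ω n i - g) 2 μ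
  mean : ∀ n ∈ A, ∀ i, ∫ ω, (X ω n i - g) ∂μ = 0
  second : ∀ n ∈ A, ∀ i, ∫ ω, ‖X ω n i - g‖ ^ 2 ∂μ = v n

variable {μ : Measure Ω} {v : ℕ → ℝ}

theorem IsTable.others_le (h : IsTable μ X g A v) (n i : ℕ) :
    others X n i ≤ (inferInstance : MeasurableSpace Ω) :=
  iSup₂_le fun p _ => (h.measurable p.1 p.2).comap_le

theorem IsTable.indep_others (h : IsTable μ X g A v) (n i : ℕ) :
    Indep (others X n i) (MeasurableSpace.comap (fun ω => X ω n i) inferInstance) μ := by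
  have := indep_iSup_of_disjoint (m := fun p : ℕ × ℕ =>
    MeasurableSpace.comap (fun ω => X ω p.1 p.2) inferInstance)
    (fun p => (h.measurable p.1 p.2).comap_le) h.indep.iIndep
    (S := {(n, i)}ᶜ) (T := {(n, i)}) disjoint_compl_left
  rwa [iSup_singleton] at this

theorem IsTable.measurableSet_reveals (h : IsTable μ X g A v)
    (hπ : ∀ t : ℕ, Measurable fun h : Fin t → ℕ × Vec d => π (List.ofFn h)) (t n i : ℕ) :
    MeasurableSet (reveals π X t n i) :=
  h.others_le n i _ (measurable_reveals (g := g) hπ t n i).1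

theorem IsTable.setIntegral_reveals (h : IsTable μ X g A v)
    (hπ : ∀ t : ℕ, Measurable fun h : Fin t → ℕ × Vec d => π (List.ofFn h)) (t n i : ℕ)
    {E : Type*} [NormedAddCommGroup E] [NormedSpace ℝ E] {f : Vec d → E} (hf : Continuous f) :
    ∫ ω in reveals π X t n i, f (X ω n i) ∂μ
      = μ.real (reveals π X t n i) • ∫ ω, f (X ω n i) ∂μ :=
  Indep.setIntegral_eq_smul (h.others_le n i) (h.indep_others n i)
    (h.measurable n i).aemeasurable (measurable_reveals (g := g) hπ t n i).1
    hf.aestronglyMeasurable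

theorem IsTable.memLp_answer (h : IsTable μ X g A v) (hA : ∀ h, π h ∈ A)
    (hπ : ∀ t : ℕ, Measurable fun h : Fin t → ℕ × Vec d => π (List.ofFn h)) (t : ℕ) :
    MemLp (fun ω => answer π (X ω) t - g) 2 μ := by
  have : (fun ω => answer π (X ω) t - g) = fun ω => ∑ n ∈ A, ∑ i ∈ Finset.range (t + 1),
      (reveals π X t n i).indicator (fun ω => X ω n i - g) ω :=
    funext fun ω => answer_sub_eq_sum hA X t ω (fun x => x - g)
  rw [this]
  exact memLp_finsetSum _ fun n hn => memLp_finsetSum _ fun i _ =>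
    (h.memLp n hn i).indicator (h.measurableSet_reveals hπ t n i)

variable [IsProbabilityMeasure μ]

theorem IsTable.integral_answer (h : IsTable μ X g A v) (hA : ∀ h, π h ∈ A)
    (hπ : ∀ t : ℕ, Measurable fun h : Fin t → ℕ × Vec d => π (List.ofFn h)) (t : ℕ) :
    ∫ ω, (answer π (X ω) t - g) ∂μ = 0 := by
  have hint : ∀ n ∈ A, ∀ i, Integrable
      ((reveals π X t n i).indicator (fun ω => X ω n i - g)) μ := fun n hn i =>
    ((h.memLp n hn i).integrable one_le_two).indicator (h.measurableSet_reveals hπ t n i)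
  simp only [answer_sub_eq_sum hA X t _ (fun x => x - g)]
  rw [integral_finsetSum _ fun n hn => integrable_finsetSum _ fun i _ => hint n hn i]
  refine Finset.sum_eq_zero fun n hn => ?_
  rw [integral_finsetSum _ fun i _ => hint n hn i]
  refine Finset.sum_eq_zero fun i _ => ?_
  rw [integral_indicator (h.measurableSet_reveals hπ t n i),
    h.setIntegral_reveals hπ t n i (f := fun x => x - g) (by fun_prop), h.mean n hn i, smul_zero]

theorem IsTable.integral_norm_sq_answer (h : IsTable μ X g A v) (hA : ∀ h, π h ∈ A)
    (hπ : ∀ t : ℕ, Measurable fun h : Fin t → ℕ × Vec d => π (List.ofFn h)) (t : ℕ) :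
    ∫ ω, ‖answer π (X ω) t - g‖ ^ 2 ∂μ = ∫ ω, v (query π (X ω) t) ∂μ := by
  have hsq : ∀ n ∈ A, ∀ i, Integrable (fun ω => ‖X ω n i - g‖ ^ 2) μ := fun n hn i =>
    (h.memLp n hn i).integrable_norm_pow two_ne_zero
  have hint : ∀ n ∈ A, ∀ i, Integrable
      ((reveals π X t n i).indicator (fun ω => ‖X ω n i - g‖ ^ 2)) μ := fun n hn i =>
    (hsq n hn i).indicator (h.measurableSet_reveals hπ t n i)
  have hint' : ∀ n ∈ A, ∀ i, Integrable
      ((reveals π X t n i).indicator (fun _ => v n)) μ := fun n _ i =>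
    (integrable_const _).indicator (h.measurableSet_reveals hπ t n i)
  have hv : ∀ ω, v (query π (X ω) t) = ∑ n ∈ A, ∑ i ∈ Finset.range (t + 1),
      (reveals π X t n i).indicator (fun _ => v n) ω := fun ω => by
    rw [Finset.sum_eq_single_of_mem (query π (X ω) t) (hA _),
      Finset.sum_eq_single_of_mem (count π (X ω) t (query π (X ω) t))
        (Finset.mem_range.2 (Nat.lt_succ_of_le (count_le _ _ _ _)))]
    · rw [Set.indicator_of_mem (show ω ∈ reveals π X t _ _ from ⟨rfl, rfl⟩)]
    · intro i _ hi
      exact Set.indicator_of_notMem (fun h => hi h.2.symm) _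
    · intro n _ hn
      exact Finset.sum_eq_zero fun i _ => Set.indicator_of_notMem (fun h => hn h.1.symm) _
  simp only [hv, answer_sub_eq_sum hA X t _ (fun x => ‖x - g‖ ^ 2)]
  rw [integral_finsetSum _ fun n hn => integrable_finsetSum _ fun i _ => hint n hn i,
    integral_finsetSum _ fun n hn => integrable_finsetSum _ fun i _ => hint' n hn i]
  refine Finset.sum_congr rfl fun n hn => ?_
  rw [integral_finsetSum _ fun i _ => hint n hn i, integral_finsetSum _ fun i _ => hint' n hn i]
  refine Finset.sum_congr rfl fun i _ => ?_
  rw [integral_indicator (h.measurableSet_reveals hπ t n i),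
    h.setIntegral_reveals hπ t n i (f := fun x => ‖x - g‖ ^ 2) (by fun_prop), h.second n hn i,
    integral_indicator (h.measurableSet_reveals hπ t n i), setIntegral_const]

theorem IsTable.integral_inner_answer (h : IsTable μ X g A v) (hA : ∀ h, π h ∈ A)
    (hπ : ∀ t : ℕ, Measurable fun h : Fin t → ℕ × Vec d => π (List.ofFn h)) (t : ℕ) :
    ∫ ω, inner ℝ (∑ j ∈ Finset.range t, (answer π (X ω) j - g)) (answer π (X ω) t - g) ∂μ = 0 := by
  set Z : Ω → Vec d := fun ω => ∑ j ∈ Finset.range t, (answer π (X ω) j - g) with hZ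
  have hZ2 : MemLp Z 2 μ := memLp_finsetSum _ fun j _ => h.memLp_answer hA hπ j
  have hsum : ∀ ω, inner ℝ (Z ω) (answer π (X ω) t - g) = ∑ n ∈ A, ∑ i ∈ Finset.range (t + 1),
      inner ℝ ((reveals π X t n i).indicator Z ω) (X ω n i - g) := fun ω => by
    rw [answer_sub_eq_sum hA X t ω (fun x => x - g), inner_sum]
    refine Finset.sum_congr rfl fun n _ => ?_
    rw [inner_sum]
    refine Finset.sum_congr rfl fun i _ => ?_
    by_cases hω : ω ∈ reveals π X t n i <;> simp [hω]
  have hind : ∀ n i, MemLp ((reveals π X t n i).indicator Z) 2 μ := fun n i =>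
    hZ2.indicator (h.measurableSet_reveals hπ t n i)
  have hint : ∀ n ∈ A, ∀ i, Integrable
      (fun ω => inner ℝ ((reveals π X t n i).indicator Z ω) (X ω n i - g)) μ := fun n hn i =>
    integrable_inner_of_memLp (hind n i) (h.memLp n hn i)
  change ∫ ω, inner ℝ (Z ω) (answer π (X ω) t - g) ∂μ = 0
  simp only [hsum]
  rw [integral_finsetSum _ fun n hn => integrable_finsetSum _ fun i _ => hint n hn i]
  refine Finset.sum_eq_zero fun n hn => ?_
  rw [integral_finsetSum _ fun i _ => hint n hn i]
  refine Finset.sum_eq_zero fun i _ => ?_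
  have hI : IndepFun ((reveals π X t n i).indicator Z) (fun ω => X ω n i - g) μ := by
    have h1 : IndepFun ((reveals π X t n i).indicator Z) (fun ω => X ω n i) μ := by
      rw [IndepFun_iff_Indep]
      exact indep_of_indep_of_le_left (h.indep_others n i)
        (measurable_reveals (g := g) hπ t n i).2.comap_le
    exact h1.comp measurable_id (measurable_id.sub_const g)
  have := hI.integral_bilin ((hind n i).integrable one_le_two)
    ((h.memLp n hn i).integrable one_le_two) (innerSL ℝ)
  simp only [h.mean n hn i, map_zero] at this
  exact this

/-- Adaptive sampling keeps the deviations from the mean uncorrelated: the second moment of their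
sum is the sum of their second moments. -/
theorem IsTable.integral_norm_sq_sum (h : IsTable μ X g A v) (hA : ∀ h, π h ∈ A)
    (hπ : ∀ t : ℕ, Measurable fun h : Fin t → ℕ × Vec d => π (List.ofFn h)) (T : ℕ) :
    ∫ ω, ‖∑ j ∈ Finset.range T, (answer π (X ω) j - g)‖ ^ 2 ∂μ
      = ∑ j ∈ Finset.range T, ∫ ω, v (query π (X ω) j) ∂μ := by
  induction T with
  | zero => simp
  | succ T ih =>
    have hZ2 : MemLp (fun ω => ∑ j ∈ Finset.range T, (answer π (X ω) j - g)) 2 μ :=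
      memLp_finsetSum _ fun j _ => h.memLp_answer hA hπ j
    have ha := h.memLp_answer hA hπ T
    have h1 := hZ2.integrable_norm_pow two_ne_zero
    have h2 := ha.integrable_norm_pow two_ne_zero
    have h3 := (integrable_inner_of_memLp hZ2 ha).const_mul 2
    have h13 : Integrable (fun ω => ‖∑ j ∈ Finset.range T, (answer π (X ω) j - g)‖ ^ 2 +
        2 * inner ℝ (∑ j ∈ Finset.range T, (answer π (X ω) j - g)) (answer π (X ω) T - g)) μ :=
      h1.add h3
    simp only [Finset.sum_range_succ, norm_add_sq_real]
    rw [integral_add h13 h2, integral_add h1 h3, integral_const_mul,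
      h.integral_inner_answer hA hπ, ih, h.integral_norm_sq_answer hA hπ]
    ring

end Moments

/-! ### Exponential moments of squared sub-Gaussian vectors -/

section SubGaussian

variable {Ω : Type*} [MeasurableSpace Ω] {μ : Measure Ω} [IsProbabilityMeasure μ]

open scoped NNReal ENNReal

/-- The exponential moment `E exp (t² / 2) = √2 ≤ 2` of a centred Gaussian `t` of variance `1/2`. -/
theorem lintegral_exp_sq_gaussianReal :
    ∫⁻ t, ENNReal.ofReal (Real.exp (t ^ 2 / 2)) ∂(gaussianReal 0 (1 / 2)) ≤ ENNReal.ofReal 2 := by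
  have hv : (1 / 2 : ℝ≥0) ≠ 0 := by norm_num
  rw [gaussianReal_of_var_ne_zero 0 hv,
    lintegral_withDensity_eq_lintegral_mul _ (measurable_gaussianPDF _ _) (by fun_prop)]
  have h : ∀ t : ℝ, (gaussianPDF 0 (1 / 2) * fun t => ENNReal.ofReal (Real.exp (t ^ 2 / 2))) t
      = ENNReal.ofReal (√2) * gaussianPDF 0 1 t := fun t => by
    rw [Pi.mul_apply, gaussianPDF, gaussianPDF,
      ← ENNReal.ofReal_mul (gaussianPDFReal_nonneg _ _ _), ← ENNReal.ofReal_mul (Real.sqrt_nonneg _)]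
    congr 1
    simp only [gaussianPDFReal_def]
    rw [mul_assoc, ← Real.exp_add, ← mul_assoc]
    congr 1
    · have h1 : √(2 * Real.pi * ((1 : ℝ≥0) : ℝ)) = √2 * √(2 * Real.pi * ((1 / 2 : ℝ≥0) : ℝ)) := by
        rw [← Real.sqrt_mul zero_le_two]
        congr 1
        push_cast
        ring
      rw [h1, mul_inv, ← mul_assoc, mul_inv_cancel₀ (by positivity), one_mul]
    · congr 1
      push_cast
      ring
  simp only [h]
  rw [lintegral_const_mul _ (measurable_gaussianPDF _ _),
    lintegral_gaussianPDF_eq_one 0 one_ne_zero, mul_one]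
  refine ENNReal.ofReal_le_ofReal ?_
  rw [Real.sqrt_le_left (by norm_num)]
  norm_num

/-- A standard sub-Gaussian variable `X` satisfies `E exp (X² / 4) ≤ 2`: with an independent centred
Gaussian `t` of variance `1/2`, the left side is `E exp (t X)`. -/
theorem lintegral_exp_sq_le {X : Ω → ℝ} (hX : HasSubgaussianMGF X 1 μ) (hm : Measurable X) :
    ∫⁻ ω, ENNReal.ofReal (Real.exp (X ω ^ 2 / 4)) ∂μ ≤ ENNReal.ofReal 2 := by
  have h1 : ∀ a : ℝ, ENNReal.ofReal (Real.exp (a ^ 2 / 4))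
      = ∫⁻ t, ENNReal.ofReal (Real.exp (t * a)) ∂(gaussianReal 0 (1 / 2)) := fun a => by
    have h := congrFun (mgf_fun_id_gaussianReal (μ := 0) (v := 1 / 2)) a
    rw [mgf] at h
    simp only [mul_comm _ a]
    rw [← ofReal_integral_eq_lintegral_ofReal (integrable_exp_mul_gaussianReal a)
      (ae_of_all _ fun _ => (Real.exp_pos _).le), h]
    congr 2
    push_cast
    ring
  simp only [h1]
  rw [lintegral_lintegral_swap (by fun_prop)]
  refine le_trans (lintegral_mono fun t => ?_) lintegral_exp_sq_gaussianReal
  rw [← ofReal_integral_eq_lintegral_ofReal (hX.integrable_exp_mul t)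
    (ae_of_all _ fun _ => (Real.exp_pos _).le)]
  refine ENNReal.ofReal_le_ofReal ((hX.mgf_le t).trans_eq ?_)
  simp

theorem exp_sq_integral_le {X : Ω → ℝ} {v : ℝ≥0} (hX : HasSubgaussianMGF X v μ)
    (hm : Measurable X) :
    Integrable (fun ω => Real.exp (X ω ^ 2 / (4 * v))) μ ∧
      ∫ ω, Real.exp (X ω ^ 2 / (4 * v)) ∂μ ≤ 2 := by
  rcases eq_or_ne v 0 with rfl | hv
  · simp
  have hv' : (0 : ℝ) < v := by positivity
  have h1 : HasSubgaussianMGF (fun ω => (√(v : ℝ))⁻¹ * X ω) 1 μ := by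
    convert hX.const_mul (√(v : ℝ))⁻¹
    rw [← NNReal.coe_inj]
    push_cast
    change 1 = (√(v : ℝ))⁻¹ ^ 2 * v
    rw [inv_pow, Real.sq_sqrt hv'.le, inv_mul_cancel₀ hv'.ne']
  have h2 := lintegral_exp_sq_le h1 (by fun_prop)
  have h3 : ∀ ω, ((√(v : ℝ))⁻¹ * X ω) ^ 2 / 4 = X ω ^ 2 / (4 * v) := fun ω => by
    rw [mul_pow, inv_pow, Real.sq_sqrt hv'.le]
    field_simp
  simp only [h3] at h2
  have hi : Integrable (fun ω => Real.exp (X ω ^ 2 / (4 * v))) μ :=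
    ⟨by fun_prop, (hasFiniteIntegral_iff_ofReal (ae_of_all _ fun _ => (Real.exp_pos _).le)).2
      (h2.trans_lt ENNReal.ofReal_lt_top)⟩
  refine ⟨hi, ?_⟩
  rw [← ofReal_integral_eq_lintegral_ofReal hi (ae_of_all _ fun _ => (Real.exp_pos _).le)] at h2
  exact (ENNReal.ofReal_le_ofReal_iff (by norm_num)).1 h2

/-- By convexity of `exp`, the bound for the coordinates carries over to the norm of the vector,
whatever the dependence between the coordinates. -/
theorem exp_norm_sq_integral_le {d : ℕ} {Y : Ω → Vec d} {v : Fin d → ℝ≥0} (hm : Measurable Y)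
    (hY : ∀ i, HasSubgaussianMGF (fun ω => Y ω i) (v i) μ) (hv : 0 < ∑ i, (v i : ℝ)) :
    Integrable (fun ω => Real.exp (‖Y ω‖ ^ 2 / (4 * ∑ i, (v i : ℝ)))) μ ∧
      ∫ ω, Real.exp (‖Y ω‖ ^ 2 / (4 * ∑ i, (v i : ℝ))) ∂μ ≤ 2 := by
  set V := ∑ i, (v i : ℝ) with hV
  have hmi : ∀ i, Measurable fun ω => Y ω i := fun i => by fun_prop
  have hw : ∑ i, (v i : ℝ) / V = 1 := by rw [← Finset.sum_div, ← hV, div_self hv.ne']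
  have hb : ∀ᵐ ω ∂μ, Real.exp (‖Y ω‖ ^ 2 / (4 * V))
      ≤ ∑ i, (v i : ℝ) / V * Real.exp (Y ω i ^ 2 / (4 * v i)) := by
    have h0 : ∀ᵐ ω ∂μ, ∀ i, v i = 0 → Y ω i = 0 := by
      refine ae_all_iff.2 fun i => ?_
      by_cases hi : v i = 0
      · have := hY i
        rw [hi] at this
        filter_upwards [this.ae_eq_zero_of_hasSubgaussianMGF_zero] with ω hω _ using hω
      · exact ae_of_all _ fun _ h => absurd h hi
    filter_upwards [h0] with ω hω
    have h1 := convexOn_exp.map_sum_le (t := Finset.univ) (w := fun i => (v i : ℝ) / V)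
      (p := fun i => Y ω i ^ 2 / (4 * v i)) (fun i _ => by positivity) hw (fun _ _ => Set.mem_univ _)
    simp only [smul_eq_mul] at h1
    refine le_trans (le_of_eq ?_) h1
    congr 1
    rw [EuclideanSpace.real_norm_sq_eq, Finset.sum_div]
    refine Finset.sum_congr rfl fun i _ => ?_
    by_cases hi : v i = 0
    · simp [hi, hω i hi]
    · have : (v i : ℝ) ≠ 0 := by exact_mod_cast hi
      field_simp
  have hi : Integrable (fun ω => ∑ i, (v i : ℝ) / V * Real.exp (Y ω i ^ 2 / (4 * v i))) μ :=
    integrable_finsetSum _ fun i _ => (exp_sq_integral_le (hY i) (hmi i)).1.const_mul _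
  have hi' : Integrable (fun ω => Real.exp (‖Y ω‖ ^ 2 / (4 * V))) μ := by
    refine hi.mono' (by fun_prop) ?_
    filter_upwards [hb] with ω hω
    rwa [Real.norm_of_nonneg (Real.exp_pos _).le]
  refine ⟨hi', (integral_mono_ae hi' hi hb).trans ?_⟩
  rw [integral_finsetSum _ fun i _ => (exp_sq_integral_le (hY i) (hmi i)).1.const_mul _]
  calc ∑ i, ∫ ω, (v i : ℝ) / V * Real.exp (Y ω i ^ 2 / (4 * v i)) ∂μ
      ≤ ∑ i, (v i : ℝ) / V * 2 := Finset.sum_le_sum fun i _ => by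
        rw [integral_const_mul]
        exact mul_le_mul_of_nonneg_left (exp_sq_integral_le (hY i) (hmi i)).2 (by positivity)
    _ = 2 := by rw [← Finset.sum_mul, hw, one_mul]

theorem exp_le_one_add_add_sq_mul_exp_abs (x : ℝ) :
    Real.exp x ≤ 1 + x + x ^ 2 * Real.exp |x| := by
  have h := Complex.norm_exp_sub_sum_le_norm_mul_exp (x : ℂ) 2
  rw [Finset.sum_range_succ, Finset.sum_range_one] at h
  simp only [pow_zero, Nat.factorial_zero, Nat.cast_one, div_one, pow_one, Nat.factorial_one,
    Complex.norm_real, Real.norm_eq_abs, sq_abs] at h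
  have h2 : Complex.exp x - (1 + x) = ((Real.exp x - (1 + x) : ℝ) : ℂ) := by push_cast; ring
  rw [h2, Complex.norm_real, Real.norm_eq_abs] at h
  linarith [le_abs_self (Real.exp x - (1 + x))]

/-- A nonnegative variable of mean `1` with an exponential moment has a sub-exponential
deviation from its mean. -/
theorem exp_mul_sub_one_integral_le {W : Ω → ℝ} (hm : Measurable W) (h0 : ∀ ω, 0 ≤ W ω)
    (hi : Integrable (fun ω => Real.exp (W ω / 4)) μ) (h2 : ∫ ω, Real.exp (W ω / 4) ∂μ ≤ 2)
    (hWi : Integrable W μ) (h1 : ∫ ω, W ω ∂μ = 1) {l : ℝ} (hl : |l| ≤ 1 / 8) :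
    Integrable (fun ω => Real.exp (l * (W ω - 1))) μ ∧
      ∫ ω, Real.exp (l * (W ω - 1)) ∂μ ≤ Real.exp (512 * l ^ 2) := by
  have hb : ∀ ω, Real.exp (l * (W ω - 1))
      ≤ 1 + l * (W ω - 1) + l ^ 2 * (256 * Real.exp (W ω / 4)) := fun ω => by
    refine (exp_le_one_add_add_sq_mul_exp_abs _).trans ?_
    have hw := h0 ω
    have hx : |W ω - 1| ≤ W ω + 1 := abs_le.2 ⟨by linarith, by linarith⟩
    have hz : 0 ≤ (W ω + 1) / 8 := by linarith
    have h3 : |l * (W ω - 1)| ≤ (W ω + 1) / 8 := by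
      rw [abs_mul]
      calc |l| * |W ω - 1| ≤ 1 / 8 * (W ω + 1) := by gcongr
        _ = _ := by ring
    have h4 : (W ω - 1) ^ 2 ≤ 128 * Real.exp ((W ω + 1) / 8) := by
      have := Real.quadratic_le_exp_of_nonneg hz
      nlinarith [hz]
    have h5 : Real.exp ((W ω + 1) / 8) * Real.exp ((W ω + 1) / 8)
        ≤ 2 * Real.exp (W ω / 4) := by
      rw [← Real.exp_add, show (W ω + 1) / 8 + (W ω + 1) / 8 = 1 / 4 + W ω / 4 by ring,
        Real.exp_add]
      have h6 : Real.exp (1 / 4) ≤ 2 := by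
        have := Real.exp_bound_div_one_sub_of_interval (x := 1 / 4) (by norm_num) (by norm_num)
        norm_num at this ⊢
        linarith
      gcongr
    have h7 : (l * (W ω - 1)) ^ 2 * Real.exp |l * (W ω - 1)|
        ≤ l ^ 2 * (256 * Real.exp (W ω / 4)) := by
      rw [mul_pow, mul_assoc]
      refine mul_le_mul_of_nonneg_left ?_ (sq_nonneg l)
      calc (W ω - 1) ^ 2 * Real.exp |l * (W ω - 1)|
          ≤ (128 * Real.exp ((W ω + 1) / 8)) * Real.exp ((W ω + 1) / 8) := by gcongr
        _ ≤ _ := by linarith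
    linarith
  have hsub : Integrable (fun ω => l * (W ω - 1)) μ :=
    (hWi.sub (integrable_const 1)).const_mul l
  have hlin : Integrable (fun ω => 1 + l * (W ω - 1)) μ :=
    (integrable_const 1).add hsub
  have hexp : Integrable (fun ω => l ^ 2 * (256 * Real.exp (W ω / 4))) μ :=
    (hi.const_mul 256).const_mul _
  have hI : Integrable (fun ω => Real.exp (l * (W ω - 1))) μ := by
    refine (hlin.add hexp).mono' (by fun_prop) (ae_of_all _ fun ω => ?_)
    rw [Real.norm_of_nonneg (Real.exp_pos _).le]
    exact hb ω
  refine ⟨hI, ?_⟩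
  calc ∫ ω, Real.exp (l * (W ω - 1)) ∂μ
      ≤ ∫ ω, (1 + l * (W ω - 1) + l ^ 2 * (256 * Real.exp (W ω / 4))) ∂μ :=
        integral_mono hI (hlin.add hexp) hb
    _ = 1 + l ^ 2 * (256 * ∫ ω, Real.exp (W ω / 4) ∂μ) := by
        rw [integral_add hlin hexp, integral_const_mul, integral_const_mul,
          integral_add (integrable_const 1) hsub,
          integral_const_mul, integral_sub hWi (integrable_const 1), h1]
        simp
    _ ≤ 1 + 512 * l ^ 2 := by nlinarith [sq_nonneg l]
    _ ≤ Real.exp (512 * l ^ 2) := by linarith [Real.add_one_le_exp (512 * l ^ 2)]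

end SubGaussian

/-! ### Concentration of the sample variance -/

section Concentration

variable {d : ℕ} {Ω : Type*} [MeasurableSpace Ω] {μ : Measure Ω}

open scoped NNReal ENNReal

theorem integral_norm_sq_sum_of_iIndepFun [IsProbabilityMeasure μ] {Y : ℕ → Ω → Vec d}
    (hI : iIndepFun Y μ) (hm : ∀ j, Measurable (Y j))
    (h2 : ∀ j, MemLp (Y j) 2 μ) (h0 : ∀ j, ∫ ω, Y j ω ∂μ = 0) (s : ℕ) :
    ∫ ω, ‖∑ j ∈ Finset.range s, Y j ω‖ ^ 2 ∂μ
      = ∑ j ∈ Finset.range s, ∫ ω, ‖Y j ω‖ ^ 2 ∂μ := by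
  induction s with
  | zero => simp
  | succ s ih =>
    have hZ2 : MemLp (fun ω => ∑ j ∈ Finset.range s, Y j ω) 2 μ := memLp_finsetSum _ fun j _ => h2 j
    have i1 := hZ2.integrable_norm_pow two_ne_zero
    have i2 := (h2 s).integrable_norm_pow two_ne_zero
    have i3 := (integrable_inner_of_memLp hZ2 (h2 s)).const_mul 2
    have i13 : Integrable (fun ω => ‖∑ j ∈ Finset.range s, Y j ω‖ ^ 2 +
        2 * inner ℝ (∑ j ∈ Finset.range s, Y j ω) (Y s ω)) μ := i1.add i3
    have hind : IndepFun (fun ω => ∑ j ∈ Finset.range s, Y j ω) (Y s) μ := by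
      have := hI.indepFun_finsetSum_of_notMem hm (s := Finset.range s) (i := s) (by simp)
      convert this using 1
      ext ω
      simp
    have hc : ∫ ω, inner ℝ (∑ j ∈ Finset.range s, Y j ω) (Y s ω) ∂μ = 0 := by
      have := hind.integral_bilin (hZ2.integrable one_le_two) ((h2 s).integrable one_le_two)
        (innerSL ℝ)
      rw [h0 s, map_zero] at this
      exact this
    simp only [Finset.sum_range_succ, norm_add_sq_real]
    rw [integral_add i13 i2, integral_add i1 i3, integral_const_mul, hc, ih]
    ring

/-- The sample variance, expressed through the deviations from any point `g`. -/
theorem sampleVar_eq (x : ℕ → Vec d) (g : Vec d) {s : ℕ} (hs : 0 < s) :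
    sampleVar x s = ((s : ℝ) - 1)⁻¹ * (∑ j ∈ Finset.range s, ‖x j - g‖ ^ 2
      - ‖(√(s : ℝ))⁻¹ • ∑ j ∈ Finset.range s, (x j - g)‖ ^ 2) := by
  have hs' : (0 : ℝ) < s := by exact_mod_cast hs
  set l := (List.range s).map x with hl
  have hlen : l.length = s := by simp [hl]
  set z := sampleMean l with hz
  have hzs : (s : ℝ) • (z - g) = ∑ j ∈ Finset.range s, (x j - g) := by
    rw [hz, sampleMean, hlen, smul_sub, smul_smul, mul_inv_cancel₀ hs'.ne', one_smul,
      Finset.sum_sub_distrib, Finset.sum_const, Finset.card_range, Nat.cast_smul_eq_nsmul ℝ]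
    rfl
  have htr : sampleVar x s = ((s : ℝ) - 1)⁻¹ * ∑ j ∈ Finset.range s, ‖x j - z‖ ^ 2 := by
    unfold sampleVar sampleCov
    rw [← hl, hlen, Matrix.trace_smul, smul_eq_mul, ← hz]
    congr 1
    rw [hl, List.map_map, ← Matrix.traceAddMonoidHom_apply, map_list_sum, List.map_map]
    change ∑ j ∈ Finset.range s, _ = _
    refine Finset.sum_congr rfl fun j _ => ?_
    simp only [Function.comp, Matrix.traceAddMonoidHom_apply, Matrix.trace_vecMulVec]
    rw [EuclideanSpace.real_norm_sq_eq, dotProduct]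
    exact Finset.sum_congr rfl fun i _ => (sq _).symm
  rw [htr]
  congr 1
  have h1 : ∀ j, ‖x j - z‖ ^ 2 = ‖x j - g‖ ^ 2 - 2 * inner ℝ (x j - g) (z - g) + ‖z - g‖ ^ 2 :=
    fun j => by rw [← norm_sub_sq_real]; congr 2; abel
  simp only [h1]
  rw [Finset.sum_add_distrib, Finset.sum_sub_distrib, ← Finset.mul_sum, ← sum_inner, ← hzs,
    norm_smul, norm_smul, inner_smul_left, real_inner_self_eq_norm_sq]
  simp only [Finset.sum_const, Finset.card_range, nsmul_eq_mul, mul_pow, norm_inv, Real.norm_eq_abs,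
    sq_abs, inv_pow, Real.sq_sqrt hs'.le, RCLike.conj_to_real]
  field_simp
  ring

/-- A sequence of independent random vectors with mean `g` whose coordinates are sub-Gaussian with
variance proxies `v c` that add up to the second moment of the deviation from `g`. -/
structure IsRow (μ : Measure Ω) (x : Ω → ℕ → Vec d) (g : Vec d) (v : Fin d → ℝ≥0) : Prop where
  measurable : ∀ i, Measurable fun ω => x ω i
  indep : iIndepFun (fun i ω => x ω i) μ
  mean : ∀ i, ∫ ω, (x ω i - g) ∂μ = 0
  subgaussian : ∀ i c, HasSubgaussianMGF (fun ω => (x ω i - g) c) (v c) μ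
  second : ∀ i, ∫ ω, ‖x ω i - g‖ ^ 2 ∂μ = ∑ c, (v c : ℝ)

theorem memLp_of_forall_coord {Y : Ω → Vec d} (hm : Measurable Y)
    (h : ∀ c, MemLp (fun ω => Y ω c) 2 μ) : MemLp Y 2 μ := by
  rw [memLp_two_iff_integrable_sq_norm hm.aestronglyMeasurable]
  simp only [EuclideanSpace.real_norm_sq_eq]
  exact integrable_finsetSum _ fun c _ => (h c).integrable_sq

variable {x : Ω → ℕ → Vec d} {g : Vec d} {v : Fin d → ℝ≥0}

theorem IsRow.indep_sub (h : IsRow μ x g v) : iIndepFun (fun i ω => x ω i - g) μ :=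
  h.indep.comp (fun _ y => y - g) fun _ => measurable_id.sub_const g

theorem IsRow.memLp (h : IsRow μ x g v) (i : ℕ) : MemLp (fun ω => x ω i - g) 2 μ :=
  memLp_of_forall_coord ((h.measurable i).sub_const g) fun c => (h.subgaussian i c).memLp 2

variable [IsProbabilityMeasure μ]

/-- The bound on the exponential moments of the normalized square `‖Y‖² / V` of a single
sub-Gaussian vector. -/
theorem exp_mul_norm_sq_sub_one_integral_le {Y : Ω → Vec d} (hm : Measurable Y)
    (hY : ∀ i, HasSubgaussianMGF (fun ω => Y ω i) (v i) μ) (hv : 0 < ∑ i, (v i : ℝ))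
    (h2 : ∫ ω, ‖Y ω‖ ^ 2 ∂μ = ∑ i, (v i : ℝ)) {l : ℝ} (hl : |l| ≤ 1 / 8) :
    Integrable (fun ω => Real.exp (l * (‖Y ω‖ ^ 2 / (∑ i, (v i : ℝ)) - 1))) μ ∧
      ∫ ω, Real.exp (l * (‖Y ω‖ ^ 2 / (∑ i, (v i : ℝ)) - 1)) ∂μ ≤ Real.exp (512 * l ^ 2) := by
  have hL : MemLp Y 2 μ := memLp_of_forall_coord hm fun c => (hY c).memLp 2
  have h := exp_norm_sq_integral_le hm hY hv
  have he : ∀ ω, ‖Y ω‖ ^ 2 / (4 * ∑ i, (v i : ℝ)) = ‖Y ω‖ ^ 2 / (∑ i, (v i : ℝ)) / 4 := fun ω => by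
    field_simp
  simp only [he] at h
  refine exp_mul_sub_one_integral_le (by fun_prop) (fun ω => by positivity) h.1 h.2
    ((hL.integrable_norm_pow two_ne_zero).div_const _) ?_ hl
  rw [integral_div, h2, div_self hv.ne']

/-- The deviation of the normalized sample variance has the exponential moments of a
sub-exponential variable. It is the difference of a sum of `s` independent variables and one more
variable of the same kind, which are separated by convexity. -/
theorem IsRow.mgf_sampleVar_le (h : IsRow μ x g v) (hv : 0 < ∑ i, (v i : ℝ)) {s : ℕ} (hs : 2 ≤ s)
    {l : ℝ} (hl : |l| ≤ 1 / 16) :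
    Integrable (fun ω => Real.exp (l * (((s : ℝ) - 1) *
      (sampleVar (x ω) s / (∑ i, (v i : ℝ)) - 1)))) μ ∧
    mgf (fun ω => ((s : ℝ) - 1) * (sampleVar (x ω) s / (∑ i, (v i : ℝ)) - 1)) μ l
      ≤ Real.exp (4096 * ((s : ℝ) - 1) * l ^ 2) := by
  set V := ∑ i, (v i : ℝ) with hV
  have hs2 : (2 : ℝ) ≤ s := by exact_mod_cast hs
  have hs0 : (0 : ℝ) < s := by linarith
  set W : ℕ → Ω → ℝ := fun j ω => ‖x ω j - g‖ ^ 2 / V - 1 with hW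
  set B : Ω → Vec d := fun ω => (√(s : ℝ))⁻¹ • ∑ j ∈ Finset.range s, (x ω j - g) with hB
  have hxm := h.measurable
  have hBm : Measurable B := by fun_prop
  have hdev : ∀ ω, ((s : ℝ) - 1) * (sampleVar (x ω) s / V - 1)
      = (∑ j ∈ Finset.range s, W j) ω - (‖B ω‖ ^ 2 / V - 1) := fun ω => by
    have hs1 : (s : ℝ) - 1 ≠ 0 := by linarith
    rw [sampleVar_eq (x ω) g (by omega)]
    simp only [hW, hB, Finset.sum_apply, Finset.sum_sub_distrib, Finset.sum_const,
      Finset.card_range, nsmul_eq_mul, ← Finset.sum_div]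
    field_simp
    ring
  have hl2 : |2 * l| ≤ 1 / 8 := by rw [abs_mul, abs_two]; linarith
  have hl2' : |-(2 * l)| ≤ 1 / 8 := by rwa [abs_neg]
  -- the sum of the normalized squares
  have hWj : ∀ j, Integrable (fun ω => Real.exp (2 * l * W j ω)) μ ∧
      mgf (W j) μ (2 * l) ≤ Real.exp (512 * (2 * l) ^ 2) := fun j =>
    exp_mul_norm_sq_sub_one_integral_le ((h.measurable j).sub_const g) (h.subgaussian j) hv
      (h.second j) hl2
  have hWI : iIndepFun W μ :=
    h.indep.comp (fun _ y => ‖y - g‖ ^ 2 / V - 1) fun _ => by fun_prop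
  have hWm : ∀ j, Measurable (W j) := fun j => by fun_prop
  have hA1 : Integrable (fun ω => Real.exp (2 * l * (∑ j ∈ Finset.range s, W j) ω)) μ :=
    hWI.integrable_exp_mul_sum hWm fun j _ => (hWj j).1
  have hA2 : ∫ ω, Real.exp (2 * l * (∑ j ∈ Finset.range s, W j) ω) ∂μ
      ≤ Real.exp (s * (512 * (2 * l) ^ 2)) := by
    have h1 := hWI.mgf_sum (t := 2 * l) hWm (Finset.range s)
    rw [mgf] at h1
    rw [h1, Real.exp_nat_mul]
    calc ∏ j ∈ Finset.range s, mgf (W j) μ (2 * l)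
        ≤ ∏ j ∈ Finset.range s, Real.exp (512 * (2 * l) ^ 2) :=
          Finset.prod_le_prod (fun _ _ => mgf_nonneg) fun j _ => (hWj j).2
      _ = _ := by rw [Finset.prod_const, Finset.card_range]
  -- the square of the normalized sum
  have hBsub : ∀ c, HasSubgaussianMGF (fun ω => B ω c) (v c) μ := fun c => by
    have hI : iIndepFun (fun j ω => (x ω j - g) c) μ :=
      h.indep.comp (fun _ y => (y - g) c) fun _ => by fun_prop
    have h1 := (HasSubgaussianMGF.sum_of_iIndepFun hI (s := Finset.range s) (c := fun _ => v c)
      fun j _ => h.subgaussian j c).const_mul (√(s : ℝ))⁻¹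
    convert h1 using 1
    · ext ω
      simp [hB]
    · rw [← NNReal.coe_inj]
      change (v c : ℝ) = (√(s : ℝ))⁻¹ ^ 2 * ((∑ i ∈ Finset.range s, v c : ℝ≥0) : ℝ)
      rw [inv_pow, Real.sq_sqrt hs0.le, Finset.sum_const, Finset.card_range, nsmul_eq_mul,
        NNReal.coe_mul, NNReal.coe_natCast, ← mul_assoc, inv_mul_cancel₀ hs0.ne', one_mul]
  have hB2 : ∫ ω, ‖B ω‖ ^ 2 ∂μ = V := by
    simp only [hB, norm_smul, mul_pow, norm_inv, Real.norm_eq_abs, sq_abs, inv_pow,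
      Real.sq_sqrt hs0.le]
    rw [integral_const_mul, integral_norm_sq_sum_of_iIndepFun h.indep_sub
      (fun j => (h.measurable j).sub_const g) h.memLp h.mean]
    simp only [h.second, Finset.sum_const, Finset.card_range, nsmul_eq_mul]
    rw [← mul_assoc, inv_mul_cancel₀ hs0.ne', one_mul]
  have hC := exp_mul_norm_sq_sub_one_integral_le hBm hBsub hv hB2 hl2'
  rw [← hV] at hC
  have hb : ∀ ω, Real.exp (l * (((s : ℝ) - 1) * (sampleVar (x ω) s / V - 1)))
      ≤ 1 / 2 * Real.exp (2 * l * (∑ j ∈ Finset.range s, W j) ω)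
        + 1 / 2 * Real.exp (-(2 * l) * (‖B ω‖ ^ 2 / V - 1)) := fun ω => by
    rw [hdev]
    have h1 := convexOn_exp.2 (Set.mem_univ (2 * l * (∑ j ∈ Finset.range s, W j) ω))
      (Set.mem_univ (-(2 * l) * (‖B ω‖ ^ 2 / V - 1)))
      (show (0 : ℝ) ≤ 1 / 2 by norm_num) (show (0 : ℝ) ≤ 1 / 2 by norm_num) (by norm_num)
    simp only [smul_eq_mul] at h1
    refine le_trans (le_of_eq ?_) h1
    congr 1
    ring
  have hbi := (hA1.const_mul (1 / 2)).add (hC.1.const_mul (1 / 2))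
  have hmeas : Measurable fun ω =>
      Real.exp (l * (((s : ℝ) - 1) * (sampleVar (x ω) s / V - 1))) := by
    simp only [hdev]
    fun_prop
  have hi : Integrable (fun ω =>
      Real.exp (l * (((s : ℝ) - 1) * (sampleVar (x ω) s / V - 1)))) μ := by
    refine hbi.mono' hmeas.aestronglyMeasurable (ae_of_all _ fun ω => ?_)
    rw [Real.norm_of_nonneg (Real.exp_pos _).le]
    exact hb ω
  refine ⟨hi, ?_⟩
  have hs4 : Real.exp (s * (512 * (2 * l) ^ 2)) ≤ Real.exp (4096 * ((s : ℝ) - 1) * l ^ 2) := by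
    apply Real.exp_le_exp.2
    nlinarith [sq_nonneg l]
  have hs5 : Real.exp (512 * (-(2 * l)) ^ 2) ≤ Real.exp (4096 * ((s : ℝ) - 1) * l ^ 2) := by
    apply Real.exp_le_exp.2
    nlinarith [sq_nonneg l]
  calc mgf (fun ω => ((s : ℝ) - 1) * (sampleVar (x ω) s / V - 1)) μ l
      ≤ ∫ ω, (1 / 2 * Real.exp (2 * l * (∑ j ∈ Finset.range s, W j) ω)
        + 1 / 2 * Real.exp (-(2 * l) * (‖B ω‖ ^ 2 / V - 1))) ∂μ := integral_mono hi hbi hb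
    _ = 1 / 2 * ∫ ω, Real.exp (2 * l * (∑ j ∈ Finset.range s, W j) ω) ∂μ
        + 1 / 2 * ∫ ω, Real.exp (-(2 * l) * (‖B ω‖ ^ 2 / V - 1)) ∂μ := by
        rw [integral_add (hA1.const_mul _) (hC.1.const_mul _), integral_const_mul,
          integral_const_mul]
    _ ≤ _ := by linarith [hC.2]

/-- The universal constant `c` of the selection rule, `1 / (4 * 4096)` with the constant `4096` of
`IsRow.mgf_sampleVar_le`. With this choice, the quadratic term in the Chernoff bound costs at most
half of what the linear term gains. -/
noncomputable def selC : ℝ := 1 / 16384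

theorem selC_pos : 0 < selC := by norm_num [selC]

/-- The Chernoff exponent that turns the bound on exponential moments into tail bounds. -/
theorem exists_chernoff {y : ℝ} (hy : 0 ≤ y) : ∃ l : ℝ, 0 ≤ l ∧ l ≤ 1 / 16 ∧
    y ≤ l * max (√(y / selC)) (y / selC) - 4096 * l ^ 2 := by
  have hc := selC_pos
  rcases le_total y selC with h | h
  · refine ⟨2 * √(selC * y), by positivity, ?_, ?_⟩
    · have : √(selC * y) ≤ selC := by
        rw [Real.sqrt_le_left hc.le]
        nlinarith
      rw [selC] at this ⊢
      linarith
    · have h1 : √(selC * y) * √(y / selC) = y := by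
        rw [← Real.sqrt_mul (by positivity), show selC * y * (y / selC) = y ^ 2 by field_simp,
          Real.sqrt_sq hy]
      have h2 : √(selC * y) * √(y / selC)
          ≤ √(selC * y) * max (√(y / selC)) (y / selC) :=
        mul_le_mul_of_nonneg_left (le_max_left _ _) (Real.sqrt_nonneg _)
      have h3 : √(selC * y) ^ 2 = selC * y := Real.sq_sqrt (by positivity)
      rw [mul_pow, h3]
      have h4 : 4096 * (2 ^ 2 * (selC * y)) = y := by rw [selC]; ring
      linarith
  · refine ⟨2 * selC, by positivity, by norm_num [selC], ?_⟩
    have h1 : selC * (y / selC) ≤ selC * max (√(y / selC)) (y / selC) :=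
      mul_le_mul_of_nonneg_left (le_max_right _ _) hc.le
    rw [mul_div_cancel₀ _ hc.ne'] at h1
    have h4 : 4096 * (2 * selC) ^ 2 = selC := by rw [selC]; norm_num
    linarith

/-- The width `bonus` of the confidence bound dominates the deviation that the Chernoff bound allows
for. -/
theorem mul_max_le_bonus {V b p : ℝ} (hd : 0 < d) (hV : 0 ≤ V) (hVb : V ≤ b * p) {y : ℝ}
    (hy : 0 ≤ y) :
    V * max (√(y / selC)) (y / selC) ≤ bonus selC d b p y := by
  have hc := selC_pos
  have hd1 : (1 : ℝ) ≤ d := by exact_mod_cast hd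
  have hd0 : (0 : ℝ) < d := by linarith
  rw [bonus, mul_assoc]
  refine mul_le_mul hVb ?_ (by positivity) (hV.trans hVb)
  refine max_le ?_ ?_
  · calc √(y / selC) ≤ √(y * d / selC) := Real.sqrt_le_sqrt (by gcongr; nlinarith)
      _ = √(y * d / selC) * 1 := (mul_one _).symm
      _ ≤ _ := mul_le_mul_of_nonneg_left (le_max_left _ _) (Real.sqrt_nonneg _)
  · calc y / selC = √(y * d / selC) * √(y / (selC * d)) := by
          rw [← Real.sqrt_mul (by positivity),
            show y * d / selC * (y / (selC * d)) = (y / selC) ^ 2 by field_simp,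
            Real.sqrt_sq (by positivity)]
      _ ≤ _ := mul_le_mul_of_nonneg_left (le_max_right _ _) (Real.sqrt_nonneg _)

/-- The upper tail of the sample variance, at the width used by the selection rule. -/
theorem IsRow.measure_sampleVar_ge_le (h : IsRow μ x g v) (hd : 0 < d) (hv : 0 < ∑ i, (v i : ℝ))
    {s : ℕ} (hs : 2 ≤ s) {b p : ℝ} (hb : ∑ i, (v i : ℝ) ≤ b * p) {y : ℝ} (hy : 0 ≤ y) :
    μ.real {ω | (∑ i, (v i : ℝ)) + bonus selC d b p y ≤ sampleVar (x ω) s}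
      ≤ Real.exp (-(((s : ℝ) - 1) * y)) := by
  obtain ⟨l, hl0, hl1, hl⟩ := exists_chernoff hy
  have hs1 : (0 : ℝ) < (s : ℝ) - 1 := by
    have : (2 : ℝ) ≤ s := by exact_mod_cast hs
    linarith
  have hm := h.mgf_sampleVar_le hv hs (l := l) (by rwa [abs_of_nonneg hl0])
  have hbo := mul_max_le_bonus hd hv.le hb hy
  set V := ∑ i, (v i : ℝ) with hV
  set M := max (√(y / selC)) (y / selC) with hM
  have h1 := measure_ge_le_exp_mul_mgf (((s : ℝ) - 1) * M) hl0 hm.1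
  refine (measureReal_mono fun ω hω => ?_).trans (h1.trans ?_)
  · have hω' : V + bonus selC d b p y ≤ sampleVar (x ω) s := hω
    refine mul_le_mul_of_nonneg_left ?_ hs1.le
    rw [le_sub_iff_add_le, le_div_iff₀ hv]
    nlinarith
  · refine (mul_le_mul_of_nonneg_left hm.2 (Real.exp_pos _).le).trans ?_
    rw [← Real.exp_add]
    apply Real.exp_le_exp.2
    nlinarith

/-- The lower tail of the sample variance, at the width used by the selection rule. -/
theorem IsRow.measure_sampleVar_le_le (h : IsRow μ x g v) (hd : 0 < d) (hv : 0 < ∑ i, (v i : ℝ))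
    {s : ℕ} (hs : 2 ≤ s) {b p : ℝ} (hb : ∑ i, (v i : ℝ) ≤ b * p) {y : ℝ} (hy : 0 ≤ y) :
    μ.real {ω | sampleVar (x ω) s ≤ (∑ i, (v i : ℝ)) - bonus selC d b p y}
      ≤ Real.exp (-(((s : ℝ) - 1) * y)) := by
  obtain ⟨l, hl0, hl1, hl⟩ := exists_chernoff hy
  have hs1 : (0 : ℝ) < (s : ℝ) - 1 := by
    have : (2 : ℝ) ≤ s := by exact_mod_cast hs
    linarith
  have hm := h.mgf_sampleVar_le hv hs (l := -l) (by rwa [abs_neg, abs_of_nonneg hl0])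
  have hbo := mul_max_le_bonus hd hv.le hb hy
  set V := ∑ i, (v i : ℝ) with hV
  set M := max (√(y / selC)) (y / selC) with hM
  have h1 := measure_le_le_exp_mul_mgf (-(((s : ℝ) - 1) * M)) (neg_nonpos.2 hl0) hm.1
  refine (measureReal_mono fun ω hω => ?_).trans (h1.trans ?_)
  · have hω' : sampleVar (x ω) s ≤ V - bonus selC d b p y := hω
    change _ ≤ -(((s : ℝ) - 1) * M)
    rw [← mul_neg]
    refine mul_le_mul_of_nonneg_left ?_ hs1.le
    rw [sub_le_iff_le_add, div_le_iff₀ hv]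
    nlinarith
  · refine (mul_le_mul_of_nonneg_left hm.2 (Real.exp_pos _).le).trans ?_
    rw [← Real.exp_add]
    apply Real.exp_le_exp.2
    nlinarith

end Concentration

/-! ### The number of suboptimal queries -/

section Regret

open scoped NNReal ENNReal

/-- A summand of a convergent Dirichlet series, bounded by a telescoping difference. -/
theorem rpow_neg_one_sub_le {p t : ℝ} (hp : 0 < p) (ht : 1 < t) :
    t ^ (-1 - p) ≤ ((t - 1) ^ (-p) - t ^ (-p)) / p := by
  have ht0 : 0 < t := by linarith
  have h1 : 0 < 1 - 1 / t := by
    rw [sub_pos, div_lt_one ht0]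
    exact ht
  have h2 : 1 + p / t ≤ (1 - 1 / t) ^ (-p) := by
    rw [Real.rpow_def_of_pos h1]
    have h3 := Real.log_le_sub_one_of_pos h1
    have h4 := Real.add_one_le_exp (Real.log (1 - 1 / t) * -p)
    have h5 : p / t = p * (1 / t) := by ring
    rw [h5]
    nlinarith
  have h3 : (t - 1) ^ (-p) = t ^ (-p) * (1 - 1 / t) ^ (-p) := by
    rw [← Real.mul_rpow ht0.le h1.le]
    congr 1
    field_simp
  have h4 : t ^ (-1 - p) = t ^ (-p) / t := by
    rw [show (-1 - p : ℝ) = -p - 1 by ring, Real.rpow_sub_one ht0.ne']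
  rw [le_div_iff₀ hp, h3, h4]
  have h5 : 0 < t ^ (-p) := Real.rpow_pos_of_pos ht0 _
  calc t ^ (-p) / t * p = t ^ (-p) * (1 + p / t) - t ^ (-p) := by ring
    _ ≤ _ := by nlinarith

theorem sum_rpow_neg_one_sub_le {p : ℝ} (hp : 0 < p) {a T : ℕ} (ha : 1 ≤ a) :
    ∑ τ ∈ Finset.Ico a T, ((τ : ℝ) + 1) ^ (-1 - p) ≤ 1 / p := by
  rcases le_total T a with h | h
  · rw [Finset.Ico_eq_empty_of_le h, Finset.sum_empty]
    positivity
  have ha' : (1 : ℝ) ≤ a := by exact_mod_cast ha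
  have key : ∑ τ ∈ Finset.Ico a T, ((τ : ℝ) + 1) ^ (-1 - p)
      ≤ ((a : ℝ) ^ (-p) - (T : ℝ) ^ (-p)) / p := by
    induction T, h using Nat.le_induction with
    | base => simp
    | succ T hT ih =>
      have hT' : (a : ℝ) ≤ T := by exact_mod_cast hT
      rw [Finset.sum_Ico_succ_top hT]
      have := rpow_neg_one_sub_le hp (t := (T : ℝ) + 1) (by linarith)
      rw [add_sub_cancel_right] at this
      push_cast
      calc _ ≤ ((a : ℝ) ^ (-p) - (T : ℝ) ^ (-p)) / p
            + ((T : ℝ) ^ (-p) - ((T : ℝ) + 1) ^ (-p)) / p := add_le_add ih this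
        _ = _ := by ring
  refine key.trans (div_le_div_of_nonneg_right ?_ hp.le)
  have h1 : (a : ℝ) ^ (-p) ≤ 1 := Real.rpow_le_one_of_one_le_of_nonpos ha' (by linarith)
  have h2 : (0 : ℝ) ≤ (T : ℝ) ^ (-p) := by positivity
  linarith

/-- `rate` inverts `bonus`. -/
theorem bonus_le_of_le_rate {d : ℕ} (hd : 0 < d) {c b p x ε : ℝ} (hc : 0 < c) (hbp : 0 < b * p)
    (hε : 0 < ε) (hx : 0 ≤ x) (h : x ≤ rate c d b p ε) : bonus c d b p x ≤ ε := by
  have hd0 : (0 : ℝ) < d := by exact_mod_cast hd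
  have hr : 0 ≤ c * ε / (b * p) := by positivity
  have h1 : x ≤ c * ε / (b * p) :=
    h.trans ((mul_le_mul_of_nonneg_left (min_le_left _ _) hr).trans_eq (mul_one _))
  have h2 : x ≤ c * ε / (b * p) * (ε / d / (b * p)) :=
    h.trans (mul_le_mul_of_nonneg_left (min_le_right _ _) hr)
  have h3 : √(x * d / c) ≤ ε / (b * p) := by
    rw [Real.sqrt_le_left (by positivity)]
    calc x * d / c ≤ (c * ε / (b * p) * (ε / d / (b * p))) * d / c := by gcongr
      _ = (ε / (b * p)) ^ 2 := by field_simp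
  have h4 : √(x * d / c) * √(x / (c * d)) ≤ ε / (b * p) := by
    rw [← Real.sqrt_mul (by positivity),
      show x * d / c * (x / (c * d)) = (x / c) ^ 2 by field_simp, Real.sqrt_sq (by positivity)]
    calc x / c ≤ (c * ε / (b * p)) / c := by gcongr
      _ = _ := by field_simp
  rw [bonus, mul_assoc, mul_max_of_nonneg _ _ (Real.sqrt_nonneg _), mul_one]
  calc b * p * max _ _ ≤ b * p * (ε / (b * p)) :=
        mul_le_mul_of_nonneg_left (max_le h3 h4) hbp.le
    _ = ε := mul_div_cancel₀ _ hbp.ne'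

theorem rate_pos {d : ℕ} (hd : 0 < d) {c b p ε : ℝ} (hc : 0 < c) (hbp : 0 < b * p) (hε : 0 < ε) :
    0 < rate c d b p ε := by
  have hd0 : (0 : ℝ) < d := by exact_mod_cast hd
  unfold rate
  positivity

variable {d : ℕ}

/-- In round `τ`, for some possible number `s` of queries, the sample variance of the optimal size
`nst` is too large, or that of the size `n` too small, by the width of the confidence bound. -/
def Misleading (c α b p : ℝ) (X : ℕ → ℕ → Vec d) (Vst Vn : ℝ) (nst n τ s : ℕ) : Prop :=
  Vst + bonus c d b p (α * Real.log ((τ : ℝ) + 1) / ((s : ℝ) - 1)) ≤ sampleVar (X nst) s ∨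
    sampleVar (X n) s ≤ Vn - bonus c d b p (α * Real.log ((τ : ℝ) + 1) / ((s : ℝ) - 1))

/-- A suboptimal size is queried only if it has been queried few times, or if one of the sample
variances is misleading. -/
theorem count_lt_of_query_eq {α b p : ℝ} {N : ℕ} {π : History d → ℕ} (hd : 0 < d)
    (hπ : IsEEGradPolicy selC α b p N π) (hα : 0 < α) (hbp : 0 < b * p) (X : ℕ → ℕ → Vec d)
    {Vst Vn : ℝ} {nst n τ : ℕ} (hst : nst ∈ Finset.Icc 1 N) (hn : n ∈ Finset.Icc 1 N)
    (hV : Vst < Vn) (hτ : 2 * N ≤ τ) (hq : query π X τ = n)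
    (hM : ∀ s ∈ Finset.Icc 2 τ, ¬ Misleading selC α b p X Vst Vn nst n τ s) :
    (count π X τ n : ℝ) < 1 + α * Real.log ((τ : ℝ) + 1) / rate selC d b p ((Vn - Vst) / 2) := by
  have hi := hπ.index_le X hst hτ
  rw [hq] at hi
  have h1 := hM (count π X τ nst) (Finset.mem_Icc.2 ⟨hπ.two_le_count X hst hτ, count_le _ _ _ _⟩)
  have h2 := hM (count π X τ n) (Finset.mem_Icc.2 ⟨hπ.two_le_count X hn hτ, count_le _ _ _ _⟩)
  rw [Misleading, not_or, not_le, not_le] at h1 h2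
  have hs : (2 : ℝ) ≤ count π X τ n := by exact_mod_cast hπ.two_le_count X hn hτ
  have hlog : 0 ≤ Real.log ((τ : ℝ) + 1) :=
    Real.log_nonneg (by linarith [Nat.cast_nonneg (α := ℝ) τ])
  have hε : 0 < (Vn - Vst) / 2 := by linarith
  have hr := rate_pos hd selC_pos hbp hε
  have h3 : rate selC d b p ((Vn - Vst) / 2)
      < α * Real.log ((τ : ℝ) + 1) / ((count π X τ n : ℝ) - 1) := by
    by_contra hcon
    have := bonus_le_of_le_rate hd selC_pos hbp hε
      (div_nonneg (mul_nonneg hα.le hlog) (by linarith)) (not_lt.1 hcon)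
    linarith [h1.1, h2.2]
  rw [lt_div_iff₀ (by linarith)] at h3
  have h4 : (count π X τ n : ℝ) - 1
      < α * Real.log ((τ : ℝ) + 1) / rate selC d b p ((Vn - Vst) / 2) := by
    rw [lt_div_iff₀ hr]
    linarith
  linarith

open Classical in
/-- The count of a suboptimal size grows past the initial two queries and the threshold of
`count_lt_of_query_eq` only in rounds in which some sample variance is misleading. -/
theorem count_le_of_misleading {α b p : ℝ} {N : ℕ} {π : History d → ℕ} (hd : 0 < d)
    (hπ : IsEEGradPolicy selC α b p N π) (hα : 0 < α) (hbp : 0 < b * p) (X : ℕ → ℕ → Vec d)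
    {Vst Vn : ℝ} {nst n : ℕ} (hst : nst ∈ Finset.Icc 1 N) (hn : n ∈ Finset.Icc 1 N)
    (hV : Vst < Vn) {T : ℕ} (hT : 0 < T) :
    (count π X T n : ℝ) ≤ 2 + α * Real.log T / rate selC d b p ((Vn - Vst) / 2)
      + ∑ τ ∈ Finset.Ico (2 * N) T, ∑ s ∈ Finset.Icc 2 τ,
        if Misleading selC α b p X Vst Vn nst n τ s then (1 : ℝ) else 0 := by
  have hr := rate_pos hd selC_pos hbp (show 0 < (Vn - Vst) / 2 by linarith)
  have hT1 : (1 : ℝ) ≤ T := by exact_mod_cast hT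
  have hu : 0 ≤ α * Real.log T / rate selC d b p ((Vn - Vst) / 2) :=
    div_nonneg (mul_nonneg hα.le (Real.log_nonneg hT1)) hr.le
  have hnn : ∀ τ, 0 ≤ ∑ s ∈ Finset.Icc 2 τ,
      if Misleading selC α b p X Vst Vn nst n τ s then (1 : ℝ) else 0 := fun τ =>
    Finset.sum_nonneg fun s _ => by split_ifs <;> norm_num
  suffices h : ∀ t ≤ T, (count π X t n : ℝ)
      ≤ 2 + α * Real.log T / rate selC d b p ((Vn - Vst) / 2)
        + ∑ τ ∈ Finset.Ico (2 * N) t, ∑ s ∈ Finset.Icc 2 τ,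
          if Misleading selC α b p X Vst Vn nst n τ s then (1 : ℝ) else 0 from h T le_rfl
  intro t ht
  induction t with
  | zero => simpa [count_zero] using by linarith
  | succ t ih =>
    have ih' := ih (by omega)
    rcases lt_or_ge t (2 * N) with h2N | h2N
    · have h1 : (count π X (t + 1) n : ℝ) ≤ 2 := by
        exact_mod_cast hπ.count_le_two X hn (by omega)
      have := Finset.sum_nonneg fun τ (_ : τ ∈ Finset.Ico (2 * N) (t + 1)) => hnn τ
      linarith
    · rw [Finset.sum_Ico_succ_top h2N, count_succ]
      by_cases hq : query π X t = n
      · rw [if_pos hq]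
        push_cast
        by_cases hM : ∀ s ∈ Finset.Icc 2 t, ¬ Misleading selC α b p X Vst Vn nst n t s
        · have h1 := count_lt_of_query_eq hd hπ hα hbp X hst hn hV h2N hq hM
          have h2 : α * Real.log ((t : ℝ) + 1) / rate selC d b p ((Vn - Vst) / 2)
              ≤ α * Real.log T / rate selC d b p ((Vn - Vst) / 2) := by
            have : (t : ℝ) + 1 ≤ T := by exact_mod_cast ht
            gcongr
          have := Finset.sum_nonneg fun τ (_ : τ ∈ Finset.Ico (2 * N) t) => hnn τ
          linarith [hnn t]
        · push Not at hM
          obtain ⟨s, hs, hM⟩ := hM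
          have h1 : (1 : ℝ) ≤ ∑ s ∈ Finset.Icc 2 t,
              if Misleading selC α b p X Vst Vn nst n t s then (1 : ℝ) else 0 := by
            refine le_trans ?_ (Finset.single_le_sum (fun s _ => ?_) hs)
            · rw [if_pos hM]
            · split_ifs <;> norm_num
          linarith
      · rw [if_neg hq, add_zero]
        linarith [hnn t]

variable {Ω : Type*} [MeasurableSpace Ω] {μ : Measure Ω}

/-- A table of independent random vectors with mean `g` that are sub-Gaussian in each row
`n ∈ A`, with variance proxies `V n c` that add up to the second moment of the deviation. -/
structure IsSubGaussianTable (μ : Measure Ω) (X : Ω → ℕ → ℕ → Vec d) (g : Vec d) (A : Finset ℕ)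
    (V : ℕ → Fin d → ℝ≥0) : Prop where
  measurable : ∀ n i, Measurable fun ω => X ω n i
  indep : iIndepFun (fun (p : ℕ × ℕ) ω => X ω p.1 p.2) μ
  mean : ∀ n ∈ A, ∀ i, ∫ ω, (X ω n i - g) ∂μ = 0
  subgaussian : ∀ n ∈ A, ∀ i c, HasSubgaussianMGF (fun ω => (X ω n i - g) c) (V n c) μ
  second : ∀ n ∈ A, ∀ i, ∫ ω, ‖X ω n i - g‖ ^ 2 ∂μ = ∑ c, (V n c : ℝ)

variable {X : Ω → ℕ → ℕ → Vec d} {g : Vec d} {A : Finset ℕ} {V : ℕ → Fin d → ℝ≥0}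

theorem IsSubGaussianTable.isRow (h : IsSubGaussianTable μ X g A V) {n : ℕ} (hn : n ∈ A) :
    IsRow μ (fun ω => X ω n) g (V n) where
  measurable := h.measurable n
  indep := h.indep.precomp (g := fun i => (n, i)) fun _ _ hij => (Prod.mk.inj hij).2
  mean := h.mean n hn
  subgaussian := h.subgaussian n hn
  second := h.second n hn

theorem IsSubGaussianTable.isTable (h : IsSubGaussianTable μ X g A V) :
    IsTable μ X g A fun n => ∑ c, (V n c : ℝ) where
  measurable := h.measurable
  indep := h.indep
  memLp _ hn := (h.isRow hn).memLp
  mean := h.mean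
  second := h.second

theorem IsRow.measurable_sampleVar {x : Ω → ℕ → Vec d} {v : Fin d → ℝ≥0} (h : IsRow μ x g v)
    {s : ℕ} (hs : 0 < s) : Measurable fun ω => sampleVar (x ω) s := by
  have := h.measurable
  simp only [fun ω => sampleVar_eq (x ω) g hs]
  fun_prop

variable [IsProbabilityMeasure μ]

theorem IsSubGaussianTable.measureReal_misleading_le (h : IsSubGaussianTable μ X g A V) (hd : 0 < d)
    {α b p : ℝ} (hα : 0 < α) {nst n : ℕ} (hst : nst ∈ A) (hn : n ∈ A)
    (h0 : 0 < ∑ c, (V nst c : ℝ)) (hV : ∑ c, (V nst c : ℝ) < ∑ c, (V n c : ℝ))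
    (hb : ∑ c, (V n c : ℝ) ≤ b * p) (τ : ℕ) {s : ℕ} (hs : 2 ≤ s) :
    MeasurableSet {ω | Misleading selC α b p (X ω) (∑ c, (V nst c : ℝ)) (∑ c, (V n c : ℝ))
        nst n τ s} ∧
    μ.real {ω | Misleading selC α b p (X ω) (∑ c, (V nst c : ℝ)) (∑ c, (V n c : ℝ)) nst n τ s}
      ≤ 2 * ((τ : ℝ) + 1) ^ (-α) := by
  have hτ : (0 : ℝ) ≤ τ := Nat.cast_nonneg τ
  have hs2 : (2 : ℝ) ≤ s := by exact_mod_cast hs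
  have hy : 0 ≤ α * Real.log ((τ : ℝ) + 1) / ((s : ℝ) - 1) :=
    div_nonneg (mul_nonneg hα.le (Real.log_nonneg (by linarith))) (by linarith)
  have he : Real.exp (-(((s : ℝ) - 1) * (α * Real.log ((τ : ℝ) + 1) / ((s : ℝ) - 1))))
      = ((τ : ℝ) + 1) ^ (-α) := by
    rw [mul_div_cancel₀ _ (by linarith), Real.rpow_def_of_pos (by linarith)]
    congr 1
    ring
  have h1 := (h.isRow hst).measure_sampleVar_ge_le hd h0 hs (hV.le.trans hb) hy
  have h2 := (h.isRow hn).measure_sampleVar_le_le hd (h0.trans hV) hs hb hy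
  rw [he] at h1 h2
  constructor
  · have m1 := (h.isRow hst).measurable_sampleVar (s := s) (by omega)
    have m2 := (h.isRow hn).measurable_sampleVar (s := s) (by omega)
    exact (measurableSet_le measurable_const m1).union (measurableSet_le m2 measurable_const)
  · exact ((measureReal_union_le _ _).trans (add_le_add h1 h2)).trans_eq (by ring)

/-- The expected number of queries of a suboptimal mini-batch size. -/
theorem IsSubGaussianTable.integral_count_le {N : ℕ} {π : History d → ℕ} {α b p : ℝ}
    (h : IsSubGaussianTable μ X g (Finset.Icc 1 N) V)
    (hd : 0 < d) (hπ : IsEEGradPolicy selC α b p N π) (hα : 2 < α) {nst n : ℕ}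
    (hst : nst ∈ Finset.Icc 1 N) (hn : n ∈ Finset.Icc 1 N)
    (h0 : 0 < ∑ c, (V nst c : ℝ)) (hV : ∑ c, (V nst c : ℝ) < ∑ c, (V n c : ℝ))
    (hb : ∑ c, (V n c : ℝ) ≤ b * p) {T : ℕ} (hT : 0 < T) :
    ∫ ω, (count π (X ω) T n : ℝ) ∂μ
      ≤ α * Real.log T / rate selC d b p ((∑ c, (V n c : ℝ) - ∑ c, (V nst c : ℝ)) / 2)
        + 2 * (α - 1) / (α - 2) := by
  classical
  set Vst := ∑ c, (V nst c : ℝ) with hVst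
  set Vn := ∑ c, (V n c : ℝ) with hVn
  have hα0 : 0 < α := by linarith
  have hbp : 0 < b * p := by linarith
  have hN : 1 ≤ N := (Finset.mem_Icc.1 hn).1.trans (Finset.mem_Icc.1 hn).2
  set u := α * Real.log T / rate selC d b p ((Vn - Vst) / 2) with hu
  have hM : ∀ τ, ∀ s ∈ Finset.Icc 2 τ,
      MeasurableSet {ω | Misleading selC α b p (X ω) Vst Vn nst n τ s} ∧
      μ.real {ω | Misleading selC α b p (X ω) Vst Vn nst n τ s} ≤ 2 * ((τ : ℝ) + 1) ^ (-α) :=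
    fun τ s hs => h.measureReal_misleading_le hd hα0 hst hn h0 hV hb τ (Finset.mem_Icc.1 hs).1
  have hfi : ∀ τ, ∀ s ∈ Finset.Icc 2 τ, (fun ω => if Misleading selC α b p (X ω) Vst Vn nst n τ s
      then (1 : ℝ) else 0)
      = {ω | Misleading selC α b p (X ω) Vst Vn nst n τ s}.indicator fun _ => (1 : ℝ) :=
    fun τ s _ => by
      ext ω
      simp [Set.indicator_apply]
  have hint : ∀ τ, ∀ s ∈ Finset.Icc 2 τ, Integrable (fun ω =>
      if Misleading selC α b p (X ω) Vst Vn nst n τ s then (1 : ℝ) else 0) μ := fun τ s hs => by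
    rw [hfi τ s hs]
    exact (integrable_const 1).indicator (hM τ s hs).1
  have hint2 : ∀ τ, Integrable (fun ω => ∑ s ∈ Finset.Icc 2 τ,
      if Misleading selC α b p (X ω) Vst Vn nst n τ s then (1 : ℝ) else 0) μ := fun τ =>
    integrable_finsetSum _ fun s hs => hint τ s hs
  have hint3 : Integrable (fun ω => ∑ τ ∈ Finset.Ico (2 * N) T, ∑ s ∈ Finset.Icc 2 τ,
      if Misleading selC α b p (X ω) Vst Vn nst n τ s then (1 : ℝ) else 0) μ :=
    integrable_finsetSum _ fun τ _ => hint2 τ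
  have hcm : Measurable fun ω => (count π (X ω) T n : ℝ) :=
    measurable_from_top.comp ((measurable_query_answer hπ.measurable h.measurable T).2.2 n)
  have hci : Integrable (fun ω => (count π (X ω) T n : ℝ)) μ := by
    refine Integrable.of_bound hcm.aestronglyMeasurable (T : ℝ) (ae_of_all _ fun ω => ?_)
    rw [Real.norm_of_nonneg (Nat.cast_nonneg _)]
    exact_mod_cast count_le _ _ _ _
  have hinner : ∀ τ ∈ Finset.Ico (2 * N) T, ∫ ω, (∑ s ∈ Finset.Icc 2 τ,
      if Misleading selC α b p (X ω) Vst Vn nst n τ s then (1 : ℝ) else 0) ∂μ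
      ≤ 2 * ((τ : ℝ) + 1) ^ (-1 - (α - 2)) := fun τ hτ => by
    have hτ2 : 2 ≤ τ := by have := (Finset.mem_Ico.1 hτ).1; omega
    rw [integral_finsetSum _ fun s hs => hint τ s hs]
    have hpos : (0 : ℝ) < (τ : ℝ) + 1 := by positivity
    calc ∑ s ∈ Finset.Icc 2 τ, ∫ ω, (if Misleading selC α b p (X ω) Vst Vn nst n τ s
          then (1 : ℝ) else 0) ∂μ
        ≤ ∑ s ∈ Finset.Icc 2 τ, 2 * ((τ : ℝ) + 1) ^ (-α) := Finset.sum_le_sum fun s hs => by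
          rw [hfi τ s hs, integral_indicator_const _ (hM τ s hs).1, smul_eq_mul, mul_one]
          exact (hM τ s hs).2
      _ = ((τ + 1 - 2 : ℕ) : ℝ) * (2 * ((τ : ℝ) + 1) ^ (-α)) := by
          rw [Finset.sum_const, Nat.card_Icc, nsmul_eq_mul]
      _ ≤ ((τ : ℝ) + 1) * (2 * ((τ : ℝ) + 1) ^ (-α)) := by
          refine mul_le_mul_of_nonneg_right ?_ (by positivity)
          exact_mod_cast Nat.sub_le _ _
      _ = 2 * ((τ : ℝ) + 1) ^ (-1 - (α - 2)) := by
          rw [show (-1 - (α - 2) : ℝ) = -α + 1 by ring, Real.rpow_add_one hpos.ne']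
          ring
  calc ∫ ω, (count π (X ω) T n : ℝ) ∂μ
      ≤ ∫ ω, (2 + u + ∑ τ ∈ Finset.Ico (2 * N) T, ∑ s ∈ Finset.Icc 2 τ,
        if Misleading selC α b p (X ω) Vst Vn nst n τ s then (1 : ℝ) else 0) ∂μ :=
        integral_mono hci ((integrable_const _).add hint3) fun ω =>
          count_le_of_misleading hd hπ hα0 hbp (X ω) hst hn hV hT
    _ = 2 + u + ∑ τ ∈ Finset.Ico (2 * N) T, ∫ ω, (∑ s ∈ Finset.Icc 2 τ,
        if Misleading selC α b p (X ω) Vst Vn nst n τ s then (1 : ℝ) else 0) ∂μ := by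
        rw [integral_add (integrable_const _) hint3, integral_finsetSum _ fun τ _ => hint2 τ]
        simp
    _ ≤ 2 + u + ∑ τ ∈ Finset.Ico (2 * N) T, 2 * ((τ : ℝ) + 1) ^ (-1 - (α - 2)) := by
        gcongr with τ hτ
        exact hinner τ hτ
    _ ≤ 2 + u + 2 * (1 / (α - 2)) := by
        rw [← Finset.mul_sum]
        gcongr
        exact sum_rpow_neg_one_sub_le (by linarith) (by omega)
    _ = u + 2 * (α - 1) / (α - 2) := by
        have : α - 2 ≠ 0 := by linarith
        field_simp
        ring

end Regret

/-! ### The second moment of the stochastic gradient -/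

section GradientMoments

open scoped NNReal ENNReal

variable {d : ℕ} {Ω : Type*} [MeasurableSpace Ω] {μ : Measure Ω} [IsProbabilityMeasure μ]
  {X : Ω → ℕ → ℕ → Vec d} {g : Vec d} {A : Finset ℕ} {V : ℕ → Fin d → ℝ≥0} {π : History d → ℕ}

theorem sum_query_eq_sum_count (hA : ∀ h, π h ∈ A) (x : ℕ → ℕ → Vec d) (v : ℕ → ℝ) (T : ℕ) :
    ∑ j ∈ Finset.range T, v (query π x j) = ∑ n ∈ A, v n * (count π x T n : ℝ) := by
  simp only [count_eq_sum, Nat.cast_sum, Finset.mul_sum]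
  rw [Finset.sum_comm]
  refine Finset.sum_congr rfl fun j _ => ?_
  rw [Finset.sum_eq_single_of_mem (query π x j) (hA _)]
  · simp
  · intro n _ hn
    simp [hn.symm]

theorem sum_count (hA : ∀ h, π h ∈ A) (x : ℕ → ℕ → Vec d) (T : ℕ) :
    ∑ n ∈ A, (count π x T n : ℝ) = T := by
  have := sum_query_eq_sum_count hA x (fun _ => 1) T
  simpa using this.symm

theorem eeGradient_eq_add (x : ℕ → ℕ → Vec d) (g : Vec d) {T : ℕ} (hT : 0 < T) :
    eeGradient π x T = g + (T : ℝ)⁻¹ • ∑ j ∈ Finset.range T, (answer π x j - g) := by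
  have hT' : (T : ℝ) ≠ 0 := by positivity
  rw [eeGradient_eq, Finset.sum_sub_distrib, Finset.sum_const, Finset.card_range, smul_sub,
    ← Nat.cast_smul_eq_nsmul ℝ, smul_smul, inv_mul_cancel₀ hT', one_smul]
  abel

theorem integrable_count
    (hπ : ∀ t : ℕ, Measurable fun h : Fin t → ℕ × Vec d => π (List.ofFn h))
    (hX : ∀ n i, Measurable fun ω => X ω n i) (T n : ℕ) :
    Integrable (fun ω => (count π (X ω) T n : ℝ)) μ := by
  have hcm : Measurable fun ω => (count π (X ω) T n : ℝ) :=
    measurable_from_top.comp ((measurable_query_answer hπ hX T).2.2 n)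
  refine Integrable.of_bound hcm.aestronglyMeasurable (T : ℝ) (ae_of_all _ fun ω => ?_)
  rw [Real.norm_of_nonneg (Nat.cast_nonneg _)]
  exact_mod_cast count_le _ _ _ _

theorem measurable_eeGradient {Ω : Type*} [MeasurableSpace Ω] {X : Ω → ℕ → ℕ → Vec d}
    (hπ : ∀ t : ℕ, Measurable fun h : Fin t → ℕ × Vec d => π (List.ofFn h))
    (hX : ∀ n i, Measurable fun ω => X ω n i) (T : ℕ) :
    Measurable fun ω => eeGradient π (X ω) T := by
  simp only [eeGradient_eq]
  exact (Finset.measurable_sum _ fun j _ =>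
    (measurable_query_answer hπ hX j).2.1).const_smul (T : ℝ)⁻¹

/-- The average of the gradients obtained by adaptive sampling is unbiased, and its second moment is
determined by the expected numbers of queries. -/
theorem IsSubGaussianTable.moments_eeGradient (h : IsSubGaussianTable μ X g A V)
    (hA : ∀ h, π h ∈ A)
    (hπ : ∀ t : ℕ, Measurable fun h : Fin t → ℕ × Vec d => π (List.ofFn h))
    {σ : ℕ → ℝ} {S : ℝ} (hV : ∀ n ∈ A, ∑ c, (V n c : ℝ) = σ n * S) {T : ℕ} (hT : 0 < T) :
    MemLp (fun ω => eeGradient π (X ω) T) 2 μ ∧ ∫ ω, eeGradient π (X ω) T ∂μ = g ∧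
      ∫ ω, ‖eeGradient π (X ω) T‖ ^ 2 ∂μ
        = ‖g‖ ^ 2 + S / (T : ℝ) ^ 2 * ∑ n ∈ A, σ n * ∫ ω, (count π (X ω) T n : ℝ) ∂μ := by
  have ht := h.isTable
  have hZ2 : MemLp (fun ω => ∑ j ∈ Finset.range T, (answer π (X ω) j - g)) 2 μ :=
    memLp_finsetSum _ fun j _ => ht.memLp_answer hA hπ j
  have hZ2' : MemLp (fun ω => (T : ℝ)⁻¹ • ∑ j ∈ Finset.range T, (answer π (X ω) j - g)) 2 μ :=
    hZ2.const_smul (T : ℝ)⁻¹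
  have hZ0 : ∫ ω, (T : ℝ)⁻¹ • ∑ j ∈ Finset.range T, (answer π (X ω) j - g) ∂μ = 0 := by
    rw [integral_smul, integral_finsetSum _ fun j _ =>
      (ht.memLp_answer hA hπ j).integrable one_le_two]
    simp [ht.integral_answer hA hπ]
  have hsq : ∫ ω, ‖(T : ℝ)⁻¹ • ∑ j ∈ Finset.range T, (answer π (X ω) j - g)‖ ^ 2 ∂μ
      = S / (T : ℝ) ^ 2 * ∑ n ∈ A, σ n * ∫ ω, (count π (X ω) T n : ℝ) ∂μ := by
    simp only [norm_smul, mul_pow, norm_inv, Real.norm_eq_abs, inv_pow, sq_abs]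
    rw [integral_const_mul, ht.integral_norm_sq_sum hA hπ]
    have hvi : ∀ j ∈ Finset.range T,
        Integrable (fun ω => ∑ c, (V (query π (X ω) j) c : ℝ)) μ := fun j _ => by
      have hm : Measurable fun ω => ∑ c, (V (query π (X ω) j) c : ℝ) :=
        (measurable_from_top (f := fun n => ∑ c, (V n c : ℝ))).comp
          (measurable_query_answer hπ h.measurable j).1
      refine Integrable.of_bound hm.aestronglyMeasurable (∑ n ∈ A, ∑ c, (V n c : ℝ))
        (ae_of_all _ fun ω => ?_)
      rw [Real.norm_of_nonneg (Finset.sum_nonneg fun c _ => NNReal.coe_nonneg _)]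
      exact Finset.single_le_sum (f := fun n => ∑ c, (V n c : ℝ))
        (fun n _ => Finset.sum_nonneg fun c _ => NNReal.coe_nonneg _) (hA _)
    rw [← integral_finsetSum _ hvi]
    simp only [fun ω => sum_query_eq_sum_count hA (X ω) (fun n => ∑ c, (V n c : ℝ)) T]
    rw [integral_finsetSum _ fun n _ => (integrable_count hπ h.measurable T n).const_mul _,
      Finset.mul_sum, Finset.mul_sum]
    refine Finset.sum_congr rfl fun n hn => ?_
    rw [integral_const_mul, hV n hn]
    field_simp
  simp only [fun ω => eeGradient_eq_add (π := π) (X ω) g hT]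
  refine ⟨(memLp_const g).add hZ2', ?_, ?_⟩
  · rw [integral_add (integrable_const g) (hZ2'.integrable one_le_two), hZ0]
    simp
  · have i2 := hZ2'.integrable_norm_pow two_ne_zero
    have i3 := (integrable_inner_of_memLp (memLp_const g) hZ2').const_mul 2
    have i13 : Integrable (fun ω => ‖g‖ ^ 2 +
        2 * inner ℝ g ((T : ℝ)⁻¹ • ∑ j ∈ Finset.range T, (answer π (X ω) j - g))) μ :=
      (integrable_const _).add i3
    simp only [norm_add_sq_real]
    rw [integral_add i13 i2, integral_add (integrable_const _) i3, integral_const_mul,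
      integral_inner (hZ2'.integrable one_le_two), hZ0, hsq]
    simp

/-- The second moment of the gradient computed by EE-Grad, when the noise level `S` is at most the
parameter `p` of the selection rule. -/
theorem IsSubGaussianTable.integral_norm_sq_eeGradient_le {N : ℕ} {α b p : ℝ}
    (h : IsSubGaussianTable μ X g (Finset.Icc 1 N) V) (hd : 0 < d)
    (hπ : IsEEGradPolicy selC α b p N π) (hα : 2 < α) {σ : ℕ → ℝ} {S : ℝ} (hS : 0 ≤ S) (hSp : S ≤ p)
    (hσ : ∀ n ∈ Finset.Icc 1 N, 0 < σ n) (hσb : ∀ n ∈ Finset.Icc 1 N, σ n ≤ b)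
    (hV : ∀ n ∈ Finset.Icc 1 N, ∑ c, (V n c : ℝ) = σ n * S)
    {nst : ℕ} (hst : nst ∈ Finset.Icc 1 N) (hmin : ∀ n ∈ Finset.Icc 1 N, σ nst ≤ σ n)
    {T : ℕ} (hT : 0 < T) :
    ∫ ω, ‖eeGradient π (X ω) T‖ ^ 2 ∂μ
      ≤ ‖g‖ ^ 2 + S * (σ nst / T + Real.log T / (T : ℝ) ^ 2 *
        ∑ n ∈ (Finset.Icc 1 N).filter fun n => 0 < σ n - σ nst,
          α * (σ n - σ nst) / rate selC d b p ((σ n - σ nst) * S / 2)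
        + 1 / (T : ℝ) ^ 2 *
          ((∑ n ∈ Finset.Icc 1 N, (σ n - σ nst)) * (2 * (α - 1) / (α - 2)))) := by
  rw [(h.moments_eeGradient hπ.mem hπ.measurable hV hT).2.2]
  rcases hS.eq_or_lt with rfl | hS0
  · simp
  have hT' : (0 : ℝ) < T := by exact_mod_cast hT
  set E : ℕ → ℝ := fun n => ∫ ω, (count π (X ω) T n : ℝ) ∂μ with hE
  have hsumE : ∑ n ∈ Finset.Icc 1 N, E n = T := by
    rw [hE, ← integral_finsetSum _ fun n _ => integrable_count hπ.measurable h.measurable T n]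
    simp only [sum_count hπ.mem]
    simp
  have hbound : ∀ n ∈ Finset.Icc 1 N, (σ n - σ nst) * E n
      ≤ (if 0 < σ n - σ nst then
          Real.log T * (α * (σ n - σ nst) / rate selC d b p ((σ n - σ nst) * S / 2)) else 0)
        + (σ n - σ nst) * (2 * (α - 1) / (α - 2)) := fun n hn => by
    by_cases hΔ : 0 < σ n - σ nst
    · rw [if_pos hΔ]
      have hb : ∑ c, (V n c : ℝ) ≤ b * p := by
        rw [hV n hn]
        exact mul_le_mul (hσb n hn) hSp hS ((hσ n hn).le.trans (hσb n hn))
      have h1 := h.integral_count_le hd hπ hα hst hn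
        (by rw [hV nst hst]; exact mul_pos (hσ nst hst) hS0)
        (by rw [hV nst hst, hV n hn]; nlinarith) hb hT
      rw [hV n hn, hV nst hst, ← sub_mul] at h1
      calc (σ n - σ nst) * E n ≤ (σ n - σ nst) * _ := mul_le_mul_of_nonneg_left h1 hΔ.le
        _ = _ := by ring
    · have : σ n - σ nst = 0 := le_antisymm (not_lt.1 hΔ) (sub_nonneg.2 (hmin n hn))
      simp [this]
  have hsum : ∑ n ∈ Finset.Icc 1 N, σ n * E n
      = σ nst * T + ∑ n ∈ Finset.Icc 1 N, (σ n - σ nst) * E n := by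
    rw [← hsumE, Finset.mul_sum, ← Finset.sum_add_distrib]
    exact Finset.sum_congr rfl fun n _ => by ring
  have hle := Finset.sum_le_sum hbound
  rw [Finset.sum_add_distrib, ← Finset.sum_filter, ← Finset.mul_sum, ← Finset.sum_mul] at hle
  have hST : 0 ≤ S / (T : ℝ) ^ 2 := by positivity
  have hle' := mul_le_mul_of_nonneg_left hle hST
  have e : S / (T : ℝ) ^ 2 * (σ nst * T) = S * (σ nst / T) := by field_simp
  rw [hsum, mul_add, e, mul_add S, mul_add S]
  refine le_trans (add_le_add_right (add_le_add_right hle' _) _) (le_of_eq ?_)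
  ring

/-- A crude bound on the second moment, without any condition on the noise level. -/
theorem IsSubGaussianTable.integral_norm_sq_eeGradient_le_crude
    (h : IsSubGaussianTable μ X g A V) (hA : ∀ h, π h ∈ A)
    (hπ : ∀ t : ℕ, Measurable fun h : Fin t → ℕ × Vec d => π (List.ofFn h))
    {σ : ℕ → ℝ} {S : ℝ} (hS : 0 ≤ S) (hV : ∀ n ∈ A, ∑ c, (V n c : ℝ) = σ n * S)
    {b : ℝ} (hb : ∀ n ∈ A, σ n ≤ b) {T : ℕ} (hT : 0 < T) :
    ∫ ω, ‖eeGradient π (X ω) T‖ ^ 2 ∂μ ≤ ‖g‖ ^ 2 + b / T * S := by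
  rw [(h.moments_eeGradient hA hπ hV hT).2.2]
  have hT' : (0 : ℝ) < T := by exact_mod_cast hT
  have hsumE : ∑ n ∈ A, ∫ ω, (count π (X ω) T n : ℝ) ∂μ = T := by
    rw [← integral_finsetSum _ fun n _ => integrable_count hπ h.measurable T n]
    simp only [sum_count hA]
    simp
  have h1 : ∑ n ∈ A, σ n * ∫ ω, (count π (X ω) T n : ℝ) ∂μ ≤ b * T := by
    rw [← hsumE, Finset.mul_sum]
    exact Finset.sum_le_sum fun n hn => mul_le_mul_of_nonneg_right (hb n hn)
      (integral_nonneg fun ω => Nat.cast_nonneg _)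
  have hST : 0 ≤ S / (T : ℝ) ^ 2 := by positivity
  calc _ ≤ ‖g‖ ^ 2 + S / (T : ℝ) ^ 2 * (b * T) := by gcongr
    _ = _ := by field_simp

end GradientMoments

/-! ### Conditioning on the past by freezing it -/

section Freezing

variable {Ω E E' : Type*} {m mΩ : MeasurableSpace Ω} [MeasurableSpace E] [MeasurableSpace E']
  {μ : Measure Ω} [IsProbabilityMeasure μ] {X : Ω → E} {Y : Ω → E'}

theorem map_prodMk_restrict (hm : m ≤ mΩ) (hX : Measurable[m] X) (hY : Measurable Y)
    (hI : Indep (MeasurableSpace.comap Y inferInstance) m μ) {s : Set Ω} (hs : MeasurableSet[m] s) :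
    (μ.restrict s).map (fun ω => (X ω, Y ω)) = ((μ.restrict s).map X).prod (μ.map Y) := by
  have hX' : Measurable X := hX.mono hm le_rfl
  have : IsProbabilityMeasure (μ.map Y) := Measure.isProbabilityMeasure_map hY.aemeasurable
  refine (Measure.prod_eq fun A B hA hB => ?_).symm
  rw [Measure.map_apply (hX'.prodMk hY) (hA.prod hB), Measure.map_apply hX' hA,
    Measure.map_apply hY hB, Measure.restrict_apply (hX' hA),
    Measure.restrict_apply ((hX'.prodMk hY) (hA.prod hB))]
  have h1 := (Indep_iff _ _ μ).1 hI (Y ⁻¹' B) (X ⁻¹' A ∩ s) ⟨B, hB, rfl⟩ ((hX hA).inter hs)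
  rw [mul_comm, ← h1]
  congr 1
  ext ω
  simp only [Set.mem_inter_iff, Set.mem_preimage, Set.mem_prod]
  tauto

/-- If `X` is known and `Y` is independent of what is known, then the conditional expectation of
`f (X, Y)` is obtained by integrating over `Y` with `X` held fixed. -/
theorem condExp_comp_prodMk_of_indep (hm : m ≤ mΩ) (hX : Measurable[m] X) (hY : Measurable Y)
    (hI : Indep (MeasurableSpace.comap Y inferInstance) m μ) {f : E × E' → ℝ} (hf : Measurable f)
    (hfi : Integrable (fun ω => f (X ω, Y ω)) μ) :
    μ[fun ω => f (X ω, Y ω) | m] =ᵐ[μ] fun ω => ∫ ω', f (X ω, Y ω') ∂μ := by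
  have hX' : Measurable X := hX.mono hm le_rfl
  have : IsProbabilityMeasure (μ.map Y) := Measure.isProbabilityMeasure_map hY.aemeasurable
  have hint : ∀ ω, ∫ ω', f (X ω, Y ω') ∂μ = ∫ y, f (X ω, y) ∂(μ.map Y) := fun ω =>
    (integral_map (f := fun y => f (X ω, y)) hY.aemeasurable
      (hf.comp measurable_prodMk_left).aestronglyMeasurable).symm
  have hsm : StronglyMeasurable fun x => ∫ y, f (x, y) ∂(μ.map Y) :=
    hf.stronglyMeasurable.integral_prod_right'
  have hprod : ∀ s, MeasurableSet[m] s →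
      Integrable f (((μ.restrict s).map X).prod (μ.map Y)) := fun s hs => by
    rw [← map_prodMk_restrict hm hX hY hI hs,
      integrable_map_measure hf.aestronglyMeasurable (hX'.prodMk hY).aemeasurable]
    exact hfi.restrict
  have hset : ∀ s, MeasurableSet[m] s →
      ∫ ω in s, f (X ω, Y ω) ∂μ = ∫ ω in s, ∫ y, f (X ω, y) ∂(μ.map Y) ∂μ := fun s hs => by
    have h1 : ∫ ω in s, f (X ω, Y ω) ∂μ
        = ∫ z, f z ∂((μ.restrict s).map fun ω => (X ω, Y ω)) :=
      (integral_map (hX'.prodMk hY).aemeasurable hf.aestronglyMeasurable).symm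
    rw [h1, map_prodMk_restrict hm hX hY hI hs, integral_prod _ (hprod s hs),
      integral_map hX'.aemeasurable hsm.aestronglyMeasurable]
  have hi : Integrable (fun ω => ∫ y, f (X ω, y) ∂(μ.map Y)) μ := by
    have := (hprod Set.univ MeasurableSet.univ).integral_prod_left
    rw [Measure.restrict_univ] at this
    exact this.comp_measurable hX'
  simp only [hint]
  refine (ae_eq_condExp_of_forall_setIntegral_eq hm hfi (fun s _ _ => hi.integrableOn)
    (fun s hs _ => (hset s hs).symm) ?_).symm
  exact (hsm.comp_measurable hX).aestronglyMeasurable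

theorem lintegral_comp_prodMk_of_indep (hm : m ≤ mΩ) (hX : Measurable[m] X) (hY : Measurable Y)
    (hI : Indep (MeasurableSpace.comap Y inferInstance) m μ) {f : E × E' → ENNReal}
    (hf : Measurable f) :
    ∫⁻ ω, f (X ω, Y ω) ∂μ = ∫⁻ ω, ∫⁻ ω', f (X ω, Y ω') ∂μ ∂μ := by
  have hX' : Measurable X := hX.mono hm le_rfl
  have : IsProbabilityMeasure (μ.map Y) := Measure.isProbabilityMeasure_map hY.aemeasurable
  have h := map_prodMk_restrict hm hX hY hI MeasurableSet.univ
  rw [Measure.restrict_univ] at h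
  rw [← lintegral_map hf (hX'.prodMk hY), h, lintegral_prod _ hf.aemeasurable,
    lintegral_map hf.lintegral_prod_right' hX']
  exact lintegral_congr fun ω => lintegral_map (by fun_prop) hY

end Freezing

/-! ### Smooth strongly convex functions -/

section Descent

variable {d : ℕ} {F : Vec d → ℝ} {m L : ℝ}

/-- A function with Lipschitz gradient lies below its quadratic upper model. -/
theorem le_quadratic_of_lipschitz_gradient (hF : Differentiable ℝ F)
    (hL : ∀ w w' : Vec d, ‖gradient F w - gradient F w'‖ ≤ L * ‖w - w'‖) (w v : Vec d) :
    F (w + v) ≤ F w + inner ℝ (gradient F w) v + L / 2 * ‖v‖ ^ 2 := by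
  set ψ : ℝ → ℝ := fun t => F (w + t • v) - t * inner ℝ (gradient F w) v
    - L / 2 * ‖v‖ ^ 2 * t ^ 2 with hψ
  have hder : ∀ t, HasDerivAt ψ (inner ℝ (gradient F (w + t • v)) v - inner ℝ (gradient F w) v
      - L / 2 * ‖v‖ ^ 2 * (2 * t)) t := fun t => by
    have h1 : HasDerivAt (fun t : ℝ => w + t • v) v t := by
      simpa using ((hasDerivAt_id t).smul_const v).const_add w
    have h2 : HasDerivAt (fun t : ℝ => F (w + t • v)) (inner ℝ (gradient F (w + t • v)) v) t := by
      have := (hF (w + t • v)).hasGradientAt.hasFDerivAt.comp_hasDerivAt t h1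
      simpa [Function.comp_def] using this
    have h3 : HasDerivAt (fun t : ℝ => t * inner ℝ (gradient F w) v)
        (inner ℝ (gradient F w) v) t := by
      simpa using (hasDerivAt_id t).mul_const (inner ℝ (gradient F w) v)
    have h4 : HasDerivAt (fun t : ℝ => L / 2 * ‖v‖ ^ 2 * t ^ 2) (L / 2 * ‖v‖ ^ 2 * (2 * t)) t := by
      simpa using (hasDerivAt_pow 2 t).const_mul (L / 2 * ‖v‖ ^ 2)
    exact (h2.sub h3).sub h4
  have hanti : AntitoneOn ψ (Set.Icc 0 1) := by
    refine antitoneOn_of_deriv_nonpos (convex_Icc 0 1)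
      (fun t _ => (hder t).continuousAt.continuousWithinAt)
      (fun t _ => (hder t).differentiableAt.differentiableWithinAt) fun t ht => ?_
    rw [interior_Icc] at ht
    rw [(hder t).deriv, ← inner_sub_left]
    have h1 := real_inner_le_norm (gradient F (w + t • v) - gradient F w) v
    have h2 := hL (w + t • v) w
    rw [add_sub_cancel_left, norm_smul, Real.norm_of_nonneg ht.1.le] at h2
    nlinarith [mul_le_mul_of_nonneg_right h2 (norm_nonneg v)]
  have h := hanti (Set.left_mem_Icc.2 zero_le_one) (Set.right_mem_Icc.2 zero_le_one) zero_le_one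
  simp only [hψ, one_smul, zero_smul, add_zero] at h
  linarith

theorem continuous_gradient
    (hL : ∀ w w' : Vec d, ‖gradient F w - gradient F w'‖ ≤ L * ‖w - w'‖) :
    Continuous (gradient F) := by
  have : LipschitzWith L.toNNReal (gradient F) := LipschitzWith.of_dist_le_mul fun w w' => by
    rw [dist_eq_norm, dist_eq_norm]
    exact (hL w w').trans (mul_le_mul_of_nonneg_right (Real.le_coe_toNNReal L) (norm_nonneg _))
  exact this.continuous

/-- The Polyak–Łojasiewicz inequality. -/
theorem gap_le_norm_sq_gradient (hm : 0 < m)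
    (hc : ∀ w w' : Vec d,
      F w' ≥ F w + inner ℝ (gradient F w) (w' - w) + 1 / 2 * m * ‖w' - w‖ ^ 2) (w wstar : Vec d) :
    2 * m * (F w - F wstar) ≤ ‖gradient F w‖ ^ 2 := by
  have h1 := hc w wstar
  have h2 := neg_le_of_abs_le (abs_real_inner_le_norm (gradient F w) (wstar - w))
  nlinarith [sq_nonneg (‖gradient F w‖ - m * ‖wstar - w‖)]

theorem strong_convexity_le_lipschitz [NeZero d] (hF : Differentiable ℝ F)
    (hL : ∀ w w' : Vec d, ‖gradient F w - gradient F w'‖ ≤ L * ‖w - w'‖)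
    (hc : ∀ w w' : Vec d,
      F w' ≥ F w + inner ℝ (gradient F w) (w' - w) + 1 / 2 * m * ‖w' - w‖ ^ 2) : m ≤ L := by
  have h1 := le_quadratic_of_lipschitz_gradient hF hL 0 (EuclideanSpace.single (0 : Fin d) 1)
  have h2 := hc 0 (0 + EuclideanSpace.single (0 : Fin d) 1)
  rw [add_sub_cancel_left] at h2
  have h3 : ‖(EuclideanSpace.single (0 : Fin d) (1 : ℝ) : Vec d)‖ = 1 := by simp
  rw [h3] at h1 h2
  linarith

theorem noiseTrace_eq (F : Vec d → ℝ) (w : Vec d) : noiseTrace F w = ‖gradient F w‖ ^ 2 := by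
  rw [noiseTrace, covShape, Matrix.trace_diagonal, EuclideanSpace.real_norm_sq_eq]

/-- One step with an unbiased gradient `G` of second moment at most `(1 + z) ‖∇F(w)‖²`. -/
theorem expected_descent {Ω : Type*} [MeasurableSpace Ω] {μ : Measure Ω} [IsProbabilityMeasure μ]
    (hm : 0 < m) (hL0 : 0 < L) (hF : Differentiable ℝ F)
    (hL : ∀ w w' : Vec d, ‖gradient F w - gradient F w'‖ ≤ L * ‖w - w'‖)
    (hc : ∀ w w' : Vec d,
      F w' ≥ F w + inner ℝ (gradient F w) (w' - w) + 1 / 2 * m * ‖w' - w‖ ^ 2) {wstar : Vec d}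
    (hs : ∀ w, F wstar ≤ F w) {G : Ω → Vec d} {w : Vec d} {η z : ℝ} (hη : 0 < η) (hz : 0 ≤ z)
    (hηz : η < 2 / (L * (1 + z))) (hG : MemLp G 2 μ) (h1 : ∫ ω, G ω ∂μ = gradient F w)
    (h2 : ∫ ω, ‖G ω‖ ^ 2 ∂μ ≤ (1 + z) * ‖gradient F w‖ ^ 2) :
    ∫ ω, F (w - η • G ω) ∂μ - F wstar
      ≤ (m * L * η ^ 2 * (1 + z) - 2 * m * η + 1) * (F w - F wstar) := by
  have hb : ∀ ω, F (w - η • G ω)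
      ≤ F w - η * inner ℝ (gradient F w) (G ω) + L / 2 * η ^ 2 * ‖G ω‖ ^ 2 := fun ω => by
    have := le_quadratic_of_lipschitz_gradient hF hL w (-(η • G ω))
    rw [inner_neg_right, inner_smul_right, norm_neg, norm_smul, mul_pow, Real.norm_eq_abs,
      sq_abs, ← sub_eq_add_neg] at this
    linarith
  have i1 := (hG.integrable one_le_two).const_inner (𝕜 := ℝ) (gradient F w)
  have i2 := hG.integrable_norm_pow two_ne_zero
  have i12 : Integrable (fun ω => F w - η * inner ℝ (gradient F w) (G ω)) μ :=
    (integrable_const _).sub (i1.const_mul η)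
  have i3 : Integrable (fun ω => F w - η * inner ℝ (gradient F w) (G ω)
      + L / 2 * η ^ 2 * ‖G ω‖ ^ 2) μ := i12.add (i2.const_mul _)
  have iF : Integrable (fun ω => F (w - η • G ω)) μ := by
    refine (i3.norm.add (integrable_const |F wstar|)).mono' ?_ (ae_of_all _ fun ω => ?_)
    · exact hF.continuous.comp_aestronglyMeasurable
        (aestronglyMeasurable_const.sub (hG.1.const_smul η))
    · have h3 := hb ω
      have h4 := hs (w - η • G ω)
      rw [Real.norm_eq_abs, Pi.add_apply, Real.norm_eq_abs]
      exact abs_le.2 ⟨by linarith [neg_abs_le (F wstar), abs_nonneg (F w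
        - η * inner ℝ (gradient F w) (G ω) + L / 2 * η ^ 2 * ‖G ω‖ ^ 2)],
        by linarith [le_abs_self (F w - η * inner ℝ (gradient F w) (G ω)
          + L / 2 * η ^ 2 * ‖G ω‖ ^ 2), abs_nonneg (F wstar)]⟩
  have h3 := integral_mono iF i3 hb
  rw [integral_add i12 (i2.const_mul _), integral_sub (integrable_const _) (i1.const_mul η),
    integral_const_mul, integral_const_mul, integral_inner (hG.integrable one_le_two), h1,
    real_inner_self_eq_norm_sq] at h3
  simp only [integral_const, probReal_univ, one_smul] at h3
  have h4 := gap_le_norm_sq_gradient hm hc w wstar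
  have h5 : η * (L * (1 + z)) < 2 := by rwa [lt_div_iff₀ (by positivity)] at hηz
  have h6 : L / 2 * η ^ 2 * ∫ ω, ‖G ω‖ ^ 2 ∂μ
      ≤ L / 2 * η ^ 2 * ((1 + z) * ‖gradient F w‖ ^ 2) := by gcongr
  have h7 : 0 ≤ η * (1 - η * (L * (1 + z)) / 2) := mul_nonneg hη.le (by linarith)
  have h8 := mul_le_mul_of_nonneg_left h4 h7
  nlinarith

theorem contraction_factor_mem (hm : 0 < m) (hmL : m ≤ L) {η z : ℝ} (hη : 0 < η) (hz : 0 < z)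
    (hηz : η < 2 / (L * (1 + z))) :
    0 < m * L * η ^ 2 * (1 + z) - 2 * m * η + 1 ∧
      m * L * η ^ 2 * (1 + z) - 2 * m * η + 1 < 1 := by
  have hL0 : 0 < L := hm.trans_le hmL
  have h5 : η * (L * (1 + z)) < 2 := by rwa [lt_div_iff₀ (by positivity)] at hηz
  constructor
  · have h1 : m * η ^ 2 * (L * (1 + z) - m) > 0 := by
      have : 0 < L * (1 + z) - m := by nlinarith
      positivity
    nlinarith [sq_nonneg (m * η - 1)]
  · have : 0 < m * η * (2 - η * (L * (1 + z))) := mul_pos (mul_pos hm hη) (by linarith)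
    nlinarith

end Descent

/-! ### Mini-batch oracles -/

section Blocks

variable {Ω Ξ ι κ : Type*} [MeasurableSpace Ω] [MeasurableSpace Ξ] {μ : Measure Ω}
  [IsProbabilityMeasure μ]

/-- Disjoint blocks of an independent family are independent. -/
theorem iIndepFun_blocks {X : ι → κ → Ω → Ξ} (hm : ∀ i j, Measurable (X i j))
    (h : iIndepFun (fun (p : (_ : ι) × κ) ω => X p.1 p.2 ω) μ) :
    iIndepFun (fun i ω j => X i j ω) μ := by
  have hp : ∀ i j, IsProbabilityMeasure (μ.map (X i j)) :=
    fun i j => Measure.isProbabilityMeasure_map (hm i j).aemeasurable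
  have hrow : ∀ i, iIndepFun (X i) μ := fun i =>
    h.precomp (g := fun j : κ => (⟨i, j⟩ : (_ : ι) × κ)) fun a b hab => by simpa using hab
  have hcurry : (MeasurableEquiv.piCurry fun (_ : ι) (_ : κ) => Ξ) ∘
      (fun ω (p : (_ : ι) × κ) => X p.1 p.2 ω) = fun ω i j => X i j ω := by
    ext; simp [Sigma.curry]
  have h1 := (iIndepFun_iff_map_fun_eq_infinitePi_map
    (X := fun (p : (_ : ι) × κ) ω => X p.1 p.2 ω) fun p => hm p.1 p.2).1 h
  rw [iIndepFun_iff_map_fun_eq_infinitePi_map (fun i => measurable_pi_lambda _ (hm i)), ← hcurry,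
    ← Measure.map_map (f := fun ω (p : (_ : ι) × κ) => X p.1 p.2 ω) (by fun_prop)
      (measurable_pi_lambda _ fun p => hm p.1 p.2), h1,
    Measure.infinitePi_map_piCurry fun i j => μ.map (X i j)]
  congr with i : 1
  rw [(iIndepFun_iff_map_fun_eq_infinitePi_map (hm i)).1 (hrow i)]

end Blocks

section Oracle

open scoped NNReal

variable {d : ℕ} {Ω Ξ : Type*} [MeasurableSpace Ω] [MeasurableSpace Ξ]

theorem OracleModel.fidelity_pos (O : OracleModel) {n : ℕ} (hn : n ∈ Finset.Icc 1 O.N) :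
    0 < O.fidelity n := by
  obtain ⟨x, hx, he⟩ := O.attained n hn
  exact Function.invFunOn_mem ⟨x, hx, he⟩

theorem OracleModel.sigmaSq_pos (O : OracleModel) {n : ℕ} (hn : n ∈ Finset.Icc 1 O.N) :
    0 < O.sigmaSq n := by
  have h1 : (0 : ℝ) < n := by exact_mod_cast (Finset.mem_Icc.1 hn).1
  have h2 := O.fidelity_pos hn
  unfold OracleModel.sigmaSq
  positivity

theorem miniBatch_sub {Ξ : Type*} (F : Vec d → ℝ) (U : ℝ → Vec d → Ξ → Vec d) (θ : ℝ) {n : ℕ}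
    (hn : 0 < n) (w : Vec d) (s : ℕ → Ξ) :
    miniBatch F U θ n w s - gradient F w = (n : ℝ)⁻¹ • ∑ j ∈ Finset.range n, U θ w (s j) := by
  have hn' : (n : ℝ) ≠ 0 := by positivity
  rw [miniBatch, Finset.sum_add_distrib, Finset.sum_const, Finset.card_range, smul_add,
    ← Nat.cast_smul_eq_nsmul ℝ, smul_smul, inv_mul_cancel₀ hn', one_smul]
  abel

theorem covShape_nonneg (F : Vec d → ℝ) (w : Vec d) (c : Fin d) : 0 ≤ covShape F w c c := by
  rw [covShape, Matrix.diagonal_apply_eq]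
  positivity

variable {μ : Measure Ω} [IsProbabilityMeasure μ] {ν : Measure Ξ} {F : Vec d → ℝ}
  {U : ℝ → Vec d → Ξ → Vec d}

theorem IsNoise.measurable_right (hU : IsNoise F U ν) {θ : ℝ} (hθ : 0 < θ) (w : Vec d) :
    Measurable (U θ w) := (hU.measurable θ hθ).comp measurable_prodMk_left

theorem IsNoise.integral_norm_sq (hU : IsNoise F U ν) {θ : ℝ} (hθ : 0 < θ) (w : Vec d) :
    ∫ x, ‖U θ w x‖ ^ 2 ∂ν = θ⁻¹ * noiseTrace F w := by
  simp only [EuclideanSpace.real_norm_sq_eq]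
  rw [integral_finsetSum _ fun c _ => ((hU.subgaussian θ hθ w c).memLp 2).integrable_sq,
    noiseTrace, Matrix.trace, Finset.mul_sum]
  refine Finset.sum_congr rfl fun c _ => ?_
  rw [Matrix.diag_apply, ← hU.cov θ hθ w c c]
  simp only [sq]

/-- The average of `n` independent perturbations of fidelity `θ` is a sub-Gaussian vector of the
kind obtained for fidelity `n θ`. -/
theorem IsNoise.average (hU : IsNoise F U ν) {θ : ℝ} (hθ : 0 < θ) (w : Vec d) {n : ℕ} (hn : 0 < n)
    {s : ℕ → Ω → Ξ} (hs : ∀ j, Measurable (s j)) (hlaw : ∀ j, μ.map (s j) = ν)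
    (hI : iIndepFun s μ) :
    ∫ ω, (n : ℝ)⁻¹ • ∑ j ∈ Finset.range n, U θ w (s j ω) ∂μ = 0 ∧
    (∀ c, HasSubgaussianMGF (fun ω => ((n : ℝ)⁻¹ • ∑ j ∈ Finset.range n, U θ w (s j ω)) c)
      (1 / (n * θ) * covShape F w c c).toNNReal μ) ∧
    ∫ ω, ‖(n : ℝ)⁻¹ • ∑ j ∈ Finset.range n, U θ w (s j ω)‖ ^ 2 ∂μ
      = 1 / (n * θ) * noiseTrace F w := by
  have hn' : (0 : ℝ) < n := by exact_mod_cast hn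
  have hm := hU.measurable_right hθ w
  have hYm : ∀ j, Measurable fun ω => U θ w (s j ω) := fun j => hm.comp (hs j)
  have hYI : iIndepFun (fun j ω => U θ w (s j ω)) μ := hI.comp (fun _ => U θ w) fun _ => hm
  have hsub : ∀ j c, HasSubgaussianMGF (fun ω => U θ w (s j ω) c)
      (θ⁻¹ * covShape F w c c).toNNReal μ := fun j c => by
    have := hU.subgaussian θ hθ w c
    rw [← hlaw j] at this
    exact this.of_map (hs j).aemeasurable
  have hL : ∀ j, MemLp (fun ω => U θ w (s j ω)) 2 μ := fun j =>
    memLp_of_forall_coord (hYm j) fun c => (hsub j c).memLp 2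
  have h0 : ∀ j, ∫ ω, U θ w (s j ω) ∂μ = 0 := fun j => by
    rw [← integral_map (f := U θ w) (hs j).aemeasurable hm.aestronglyMeasurable, hlaw,
      hU.mean_zero θ hθ]
  have h2 : ∀ j, ∫ ω, ‖U θ w (s j ω)‖ ^ 2 ∂μ = θ⁻¹ * noiseTrace F w := fun j => by
    rw [← integral_map (f := fun x => ‖U θ w x‖ ^ 2) (hs j).aemeasurable
      (by fun_prop), hlaw, hU.integral_norm_sq hθ]
  refine ⟨?_, fun c => ?_, ?_⟩
  · rw [integral_smul, integral_finsetSum _ fun j _ => (hL j).integrable one_le_two]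
    simp [h0]
  · have hIc : iIndepFun (fun j ω => U θ w (s j ω) c) μ :=
      hYI.comp (fun _ y => y c) fun _ => by fun_prop
    have h1 := (HasSubgaussianMGF.sum_of_iIndepFun hIc (s := Finset.range n)
      (c := fun _ => (θ⁻¹ * covShape F w c c).toNNReal) fun j _ => hsub j c).const_mul (n : ℝ)⁻¹
    have hcov := covShape_nonneg F w c
    convert h1 using 1
    · ext ω
      simp
    · rw [← NNReal.coe_inj, Real.coe_toNNReal _ (by positivity)]
      change _ = ((n : ℝ)⁻¹) ^ 2 *
        ((∑ i ∈ Finset.range n, (θ⁻¹ * covShape F w c c).toNNReal : ℝ≥0) : ℝ)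
      rw [Finset.sum_const, Finset.card_range, nsmul_eq_mul, NNReal.coe_mul, NNReal.coe_natCast,
        Real.coe_toNNReal _ (by positivity)]
      field_simp
  · simp only [norm_smul, mul_pow, norm_inv, Real.norm_eq_abs, inv_pow, sq_abs]
    rw [integral_const_mul, integral_norm_sq_sum_of_iIndepFun hYI hYm hL h0]
    simp only [h2, Finset.sum_const, Finset.card_range, nsmul_eq_mul]
    field_simp

end Oracle

namespace Run

open scoped NNReal

variable {d : ℕ} {Ω Ξ : Type*} (R : Run d Ω Ξ)

/-- The outputs of the mini-batch oracles on iteration `k` at the point `w` as a function of the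
seeds `s`. The rows of infeasible mini-batch sizes, which are never queried, are set to `0`. -/
@[irreducible] noncomputable def table (k : ℕ) (w : Vec d) (s : ℕ × ℕ × ℕ → Ξ) (n i : ℕ) : Vec d :=
  if n ∈ Finset.Icc 1 (R.oracle k).N then
    miniBatch R.F (R.U k) ((R.oracle k).fidelity n) n w fun j => s (n, i, j)
  else 0

/-- One SGD step at `w`, in which the strategy `π` selects the mini-batch sizes. -/
noncomputable def step (k : ℕ) (π : History d → ℕ) (w : Vec d) (s : ℕ × ℕ × ℕ → Ξ) : Vec d :=
  w - R.η k • eeGradient π (R.table k w s) R.T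

variable {R}

theorem eeGradient_table {k : ℕ} {π : History d → ℕ}
    (hA : ∀ h, π h ∈ Finset.Icc 1 (R.oracle k).N) (ω : Ω) (w : Vec d) (T : ℕ) :
    eeGradient π (R.table k w fun p => R.seed k p ω) T
      = eeGradient π (R.oracleOutput k ω w) T := by
  unfold eeGradient
  rw [historyAfter_congr π _ (R.oracleOutput k ω w) fun j _ => ?_]
  rw [table, if_pos (show query π _ j ∈ _ from hA _)]
  rfl

theorem sum_varianceProxy (k : ℕ) (w : Vec d) {n : ℕ} (hn : n ∈ Finset.Icc 1 (R.oracle k).N) :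
    ∑ i, (((R.oracle k).sigmaSq n * covShape R.F w i i).toNNReal : ℝ)
      = (R.oracle k).sigmaSq n * noiseTrace R.F w := by
  rw [noiseTrace, Matrix.trace, Finset.mul_sum]
  refine Finset.sum_congr rfl fun e _ => ?_
  rw [Real.coe_toNNReal _ (mul_nonneg ((R.oracle k).sigmaSq_pos hn).le (covShape_nonneg _ _ _))]
  rfl

theorem table_sub {k : ℕ} (w : Vec d) {n : ℕ} (hn : n ∈ Finset.Icc 1 (R.oracle k).N) (i : ℕ)
    (s : ℕ × ℕ × ℕ → Ξ) :
    R.table k w s n i - gradient R.F w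
      = (n : ℝ)⁻¹ • ∑ j ∈ Finset.range n, R.U k ((R.oracle k).fidelity n) w (s (n, i, j)) := by
  rw [table, if_pos hn, miniBatch_sub _ _ _ (Finset.mem_Icc.1 hn).1]

variable [MeasurableSpace Ω] [MeasurableSpace Ξ] {c : ℝ} {μ : Measure Ω} {ν : Measure Ξ}
  {ℱ : Filtration ℕ (inferInstance : MeasurableSpace Ω)}

theorem iter_succ (hR : R.Admissible c μ ν ℱ) (k : ℕ) (ω : Ω) :
    R.iter (k + 1) ω = R.step k (R.π k) (R.iter k ω) fun p => R.seed k p ω := by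
  rw [step, eeGradient_table (hR.policy k).mem]
  rfl

/-- The optimal mini-batch SGD algorithm is the case of a constant strategy. -/
theorem optIter_succ (hR : R.Admissible c μ ν ℱ) (k : ℕ) (ω : Ω) :
    R.optIter (k + 1) ω
      = R.step k (fun _ => R.nStar k) (R.optIter k ω) fun p => R.seed k p ω := by
  rw [step, eeGradient_table fun _ => (hR.isOptimal k).1, eeGradient_eq]
  simp only [answer_const]
  rfl

theorem measurable_table (hR : R.Admissible c μ ν ℱ) (hg : Continuous (gradient R.F)) (k n i : ℕ) :
    Measurable fun z : Vec d × (ℕ × ℕ × ℕ → Ξ) => R.table k z.1 z.2 n i := by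
  by_cases hn : n ∈ Finset.Icc 1 (R.oracle k).N
  · have hθ := (R.oracle k).fidelity_pos hn
    simp only [table, if_pos hn, miniBatch]
    refine (Finset.measurable_sum _ fun j _ => ?_).const_smul (n : ℝ)⁻¹
    refine (hg.measurable.comp measurable_fst).add ?_
    exact ((hR.noise k).measurable _ hθ).comp
      (measurable_fst.prodMk ((measurable_pi_apply (n, i, j)).comp measurable_snd))
  · simp only [table, if_neg hn]
    exact measurable_const

theorem measurable_step (hR : R.Admissible c μ ν ℱ) (hg : Continuous (gradient R.F)) (k : ℕ)
    {π : History d → ℕ} (hπ : ∀ t : ℕ, Measurable fun h : Fin t → ℕ × Vec d => π (List.ofFn h)) :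
    Measurable fun z : Vec d × (ℕ × ℕ × ℕ → Ξ) => R.step k π z.1 z.2 :=
  measurable_fst.sub ((measurable_eeGradient hπ (measurable_table hR hg k) R.T).const_smul (R.η k))

theorem measurable_seed (hR : R.Admissible c μ ν ℱ) (k : ℕ) (p : ℕ × ℕ × ℕ) :
    Measurable (R.seed k p) := (hR.measurable_seed k p).mono (ℱ.le _) le_rfl

variable [IsProbabilityMeasure μ]

/-- The outputs of the mini-batch oracles are independent, as they use different seeds. -/
theorem iIndepFun_table (hR : R.Admissible c μ ν ℱ) (k : ℕ) (w : Vec d) :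
    iIndepFun (fun (q : ℕ × ℕ) ω => R.table k w (fun p => R.seed k p ω) q.1 q.2) μ := by
  have hblock : iIndepFun (fun (q : ℕ × ℕ) ω (j : ℕ) => R.seed k (q.1, q.2, j) ω) μ := by
    refine iIndepFun_blocks (X := fun (q : ℕ × ℕ) j => R.seed k (q.1, q.2, j))
      (fun q j => measurable_seed hR k _) ?_
    refine (hR.seed_iIndep k).precomp
      (g := fun p : (_ : ℕ × ℕ) × ℕ => (p.1.1, p.1.2, p.2)) fun a b hab => ?_
    obtain ⟨⟨a1, a2⟩, a3⟩ := a
    obtain ⟨⟨b1, b2⟩, b3⟩ := b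
    simp only [Prod.mk.injEq] at hab
    obtain ⟨rfl, rfl, rfl⟩ := hab
    rfl
  let φ : ℕ × ℕ → (ℕ → Ξ) → Vec d := fun q s =>
    if q.1 ∈ Finset.Icc 1 (R.oracle k).N then
      miniBatch R.F (R.U k) ((R.oracle k).fidelity q.1) q.1 w s else 0
  have hφm : ∀ q, Measurable (φ q) := fun q => by
    by_cases hq : q.1 ∈ Finset.Icc 1 (R.oracle k).N
    · simp only [φ, if_pos hq, miniBatch]
      refine (Finset.measurable_sum _ fun j _ => ?_).const_smul ((q.1 : ℝ)⁻¹)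
      exact (((hR.noise k).measurable_right ((R.oracle k).fidelity_pos hq) w).comp
        (measurable_pi_apply j)).const_add _
    · simp only [φ, if_neg hq]
      exact measurable_const
  have h := hblock.comp φ hφm
  unfold table
  exact h

theorem table_moments (hR : R.Admissible c μ ν ℱ) (k : ℕ) (w : Vec d) {n : ℕ}
    (hn : n ∈ Finset.Icc 1 (R.oracle k).N) (i : ℕ) :
    ∫ ω, (R.table k w (fun p => R.seed k p ω) n i - gradient R.F w) ∂μ = 0 ∧
    (∀ e, HasSubgaussianMGF
      (fun ω => (R.table k w (fun p => R.seed k p ω) n i - gradient R.F w) e)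
      ((R.oracle k).sigmaSq n * covShape R.F w e e).toNNReal μ) ∧
    ∫ ω, ‖R.table k w (fun p => R.seed k p ω) n i - gradient R.F w‖ ^ 2 ∂μ
      = (R.oracle k).sigmaSq n * noiseTrace R.F w := by
  simp only [table_sub w hn i]
  exact (hR.noise k).average ((R.oracle k).fidelity_pos hn) w (Finset.mem_Icc.1 hn).1
    (fun j => measurable_seed hR k (n, i, j)) (fun j => hR.seed_law k _)
    ((hR.seed_iIndep k).precomp (g := fun j : ℕ => (n, i, j)) fun a b hab => by simpa using hab)

theorem isSubGaussianTable (hR : R.Admissible c μ ν ℱ) (hg : Continuous (gradient R.F)) (k : ℕ)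
    (w : Vec d) :
    IsSubGaussianTable μ (fun ω => R.table k w fun p => R.seed k p ω) (gradient R.F w)
      (Finset.Icc 1 (R.oracle k).N)
      fun n i => ((R.oracle k).sigmaSq n * covShape R.F w i i).toNNReal where
  measurable n i :=
    have hz : Measurable fun ω => (w, fun p => R.seed k p ω) :=
      measurable_const.prodMk (measurable_pi_lambda _ fun p => measurable_seed hR k p)
    have h := (measurable_table hR hg k n i).comp hz
    h
  indep := iIndepFun_table hR k w
  mean _ hn i := (table_moments hR k w hn i).1
  subgaussian _ hn i := (table_moments hR k w hn i).2.1
  second _ hn i := (table_moments hR k w hn i).2.2.trans (sum_varianceProxy k w hn).symm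

end Run

namespace Run

/-! ### The iterates -/

section Iterates

variable {d : ℕ} {Ω Ξ : Type*} [MeasurableSpace Ω] [MeasurableSpace Ξ] {R : Run d Ω Ξ}
  {c : ℝ} {μ : Measure Ω} {ν : Measure Ξ}
  {ℱ : Filtration ℕ (inferInstance : MeasurableSpace Ω)}
  {pol : ℕ → History d → ℕ} {W : ℕ → Ω → Vec d} {m L : ℝ} {wstar : Vec d}

/-- `W` is the sequence of iterates of SGD in which the strategy `pol k` selects the mini-batch
sizes of iteration `k`. -/
structure IsSGD (R : Run d Ω Ξ) (pol : ℕ → History d → ℕ) (W : ℕ → Ω → Vec d) : Prop where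
  zero : ∀ ω, W 0 ω = R.w₀ ω
  succ : ∀ k ω, W (k + 1) ω = R.step k (pol k) (W k ω) fun p => R.seed k p ω
  measurable_pol : ∀ k t, Measurable fun h : Fin t → ℕ × Vec d => pol k (List.ofFn h)
  mem : ∀ k h, pol k h ∈ Finset.Icc 1 (R.oracle k).N

theorem isSGD_iter (hR : R.Admissible c μ ν ℱ) : IsSGD R R.π R.iter where
  zero _ := rfl
  succ := iter_succ hR
  measurable_pol k := (hR.policy k).measurable
  mem k := (hR.policy k).mem

theorem isSGD_optIter (hR : R.Admissible c μ ν ℱ) : IsSGD R (fun k _ => R.nStar k) R.optIter where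
  zero _ := rfl
  succ := optIter_succ hR
  measurable_pol _ _ := measurable_const
  mem k _ := (hR.isOptimal k).1

theorem IsSGD.measurable (hW : IsSGD R pol W) (hR : R.Admissible c μ ν ℱ)
    (hg : Continuous (gradient R.F)) (k : ℕ) : Measurable[ℱ k] (W k) := by
  induction k with
  | zero =>
    have : W 0 = R.w₀ := funext hW.zero
    rw [this]
    exact hR.measurable_w₀
  | succ k ih =>
    have h1 : Measurable[ℱ (k + 1)] (W k) := ih.mono (ℱ.mono k.le_succ) le_rfl
    have h2 : Measurable[ℱ (k + 1)] fun ω (p : ℕ × ℕ × ℕ) => R.seed k p ω :=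
      @measurable_pi_lambda _ _ _ (ℱ (k + 1)) _ _ fun p => hR.measurable_seed k p
    have h3 := (measurable_step hR hg k (hW.measurable_pol k)).comp (h1.prodMk h2)
    have h4 : W (k + 1) = fun ω => R.step k (pol k) (W k ω) fun p => R.seed k p ω :=
      funext (hW.succ k)
    rw [h4]
    exact h3

theorem measurable_seeds (hR : R.Admissible c μ ν ℱ) (k : ℕ) :
    Measurable fun ω (p : ℕ × ℕ × ℕ) => R.seed k p ω :=
  measurable_pi_lambda _ fun p => measurable_seed hR k p

theorem beta_pos (hR : R.Admissible c μ ν ℱ) (k : ℕ) : 0 < R.β k :=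
  ((R.oracle k).sigmaSq_pos (hR.isOptimal k).1).trans_le (hR.le_β k _ (hR.isOptimal k).1)

variable [IsProbabilityMeasure μ]

theorem IsSGD.moments_eeGradient (hW : IsSGD R pol W) (hR : R.Admissible c μ ν ℱ)
    (hg : Continuous (gradient R.F)) (k : ℕ) (w : Vec d) :
    MemLp (fun ω => eeGradient (pol k) (R.table k w fun p => R.seed k p ω) R.T) 2 μ ∧
    ∫ ω, eeGradient (pol k) (R.table k w fun p => R.seed k p ω) R.T ∂μ = gradient R.F w ∧
    ∫ ω, ‖eeGradient (pol k) (R.table k w fun p => R.seed k p ω) R.T‖ ^ 2 ∂μ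
      ≤ (1 + R.β k / R.T) * ‖gradient R.F w‖ ^ 2 := by
  have ht := isSubGaussianTable hR hg k w
  have hV : ∀ n ∈ Finset.Icc 1 (R.oracle k).N, _ := fun n hn => sum_varianceProxy k w hn
  have h1 := ht.moments_eeGradient (hW.mem k) (hW.measurable_pol k) hV hR.T_pos
  refine ⟨h1.1, h1.2.1, ?_⟩
  have h2 := ht.integral_norm_sq_eeGradient_le_crude (hW.mem k) (hW.measurable_pol k)
    (by rw [noiseTrace_eq]; positivity) hV (hR.le_β k) hR.T_pos
  rw [noiseTrace_eq] at h2
  linarith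

theorem memLp_gradient_comp {F : Vec d → ℝ}
    (hL : ∀ w w' : Vec d, ‖gradient F w - gradient F w'‖ ≤ L * ‖w - w'‖) {X : Ω → Vec d}
    (hX : MemLp X 2 μ) : MemLp (fun ω => gradient F (X ω)) 2 μ := by
  have h0 (a : ℝ) : MemLp (fun ω => a + L * ‖X ω‖) 2 μ := (memLp_const a).add (hX.norm.const_mul L)
  have h1 := h0 ‖gradient F 0‖
  have hm : AEStronglyMeasurable (fun ω => gradient F (X ω)) μ :=
    (continuous_gradient hL).comp_aestronglyMeasurable hX.1
  refine MemLp.mono h1 hm (ae_of_all _ fun ω => ?_)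
  have h2 := hL (X ω) 0
  rw [sub_zero] at h2
  have h3 := norm_sub_norm_le (gradient F (X ω)) (gradient F 0)
  rw [Real.norm_eq_abs]
  exact le_trans (by linarith) (le_abs_self _)

/-- Given the past, the second moment of the stochastic gradient at an iterate is at most a multiple
of the squared norm of the gradient there. -/
theorem IsSGD.memLp_eeGradient (hW : IsSGD R pol W) (hR : R.Admissible c μ ν ℱ)
    (hg : Continuous (gradient R.F)) (k : ℕ)
    (hgW : MemLp (fun ω => gradient R.F (W k ω)) 2 μ) :
    MemLp (fun ω => eeGradient (pol k) (R.table k (W k ω) fun p => R.seed k p ω) R.T) 2 μ := by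
  have hfm : Measurable fun z : Vec d × (ℕ × ℕ × ℕ → Ξ) =>
      eeGradient (pol k) (R.table k z.1 z.2) R.T :=
    measurable_eeGradient (hW.measurable_pol k) (measurable_table hR hg k) R.T
  have hWm := (hW.measurable hR hg k).mono (ℱ.le k) le_rfl
  have hpair : Measurable fun ω => (W k ω, fun p => R.seed k p ω) :=
    hWm.prodMk (measurable_seeds hR k)
  have hGm : Measurable fun ω =>
      eeGradient (pol k) (R.table k (W k ω) fun p => R.seed k p ω) R.T := by
    have h := hfm.comp hpair
    exact h
  have h1 := lintegral_comp_prodMk_of_indep (ℱ.le k) (hW.measurable hR hg k)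
    (measurable_seeds hR k) (hR.seed_indep_past k)
    (f := fun z : Vec d × (ℕ × ℕ × ℕ → Ξ) =>
      ENNReal.ofReal (‖eeGradient (pol k) (R.table k z.1 z.2) R.T‖ ^ 2))
    (hfm.norm.pow_const 2).ennreal_ofReal
  have h2 : ∀ ω, ∫⁻ ω', ENNReal.ofReal
      (‖eeGradient (pol k) (R.table k (W k ω) fun p => R.seed k p ω') R.T‖ ^ 2) ∂μ
      ≤ ENNReal.ofReal ((1 + R.β k / R.T) * ‖gradient R.F (W k ω)‖ ^ 2) := fun ω => by
    have h3 := hW.moments_eeGradient hR hg k (W k ω)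
    rw [← ofReal_integral_eq_lintegral_ofReal (h3.1.integrable_norm_pow two_ne_zero)
      (ae_of_all _ fun _ => sq_nonneg _)]
    exact ENNReal.ofReal_le_ofReal h3.2.2
  have hβ := beta_pos hR k
  have h4 : Integrable (fun ω => (1 + R.β k / R.T) * ‖gradient R.F (W k ω)‖ ^ 2) μ :=
    (hgW.integrable_norm_pow two_ne_zero).const_mul _
  have h5 := (hasFiniteIntegral_iff_ofReal (ae_of_all μ fun ω =>
    (show (0 : ℝ) ≤ (1 + R.β k / R.T) * ‖gradient R.F (W k ω)‖ ^ 2 by positivity))).1 h4.2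
  rw [memLp_two_iff_integrable_sq_norm hGm.aestronglyMeasurable]
  refine ⟨(hGm.norm.pow_const 2).aestronglyMeasurable, ?_⟩
  rw [hasFiniteIntegral_iff_ofReal (ae_of_all _ fun ω => sq_nonneg _)]
  refine lt_of_eq_of_lt ?_ ((lintegral_mono h2).trans_lt h5)
  exact h1

theorem IsSGD.memLp (hW : IsSGD R pol W) (hR : R.Admissible c μ ν ℱ)
    (hL : ∀ w w' : Vec d, ‖gradient R.F w - gradient R.F w'‖ ≤ L * ‖w - w'‖) (k : ℕ) :
    MemLp (W k) 2 μ := by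
  induction k with
  | zero =>
    have : W 0 = R.w₀ := funext hW.zero
    rw [this]
    exact hR.memLp_w₀
  | succ k ih =>
    have hG := hW.memLp_eeGradient hR (continuous_gradient hL) k (memLp_gradient_comp hL ih)
    have h4 : W (k + 1) = fun ω => W k ω
        - R.η k • eeGradient (pol k) (R.table k (W k ω) fun p => R.seed k p ω) R.T :=
      funext (hW.succ k)
    rw [h4]
    exact ih.sub (hG.const_smul (R.η k))

theorem integrable_comp_of_memLp {F : Vec d → ℝ} (hF : Differentiable ℝ F)
    (hL : ∀ w w' : Vec d, ‖gradient F w - gradient F w'‖ ≤ L * ‖w - w'‖)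
    (hs : ∀ w, F wstar ≤ F w) {X : Ω → Vec d} (hX : MemLp X 2 μ) :
    Integrable (fun ω => F (X ω)) μ := by
  have i1 : Integrable (fun ω => F 0 + inner ℝ (gradient F 0) (X ω) + L / 2 * ‖X ω‖ ^ 2) μ :=
    ((integrable_const _).add ((hX.integrable one_le_two).const_inner (𝕜 := ℝ) (gradient F 0))).add
      ((hX.integrable_norm_pow two_ne_zero).const_mul _)
  refine (i1.norm.add (integrable_const |F wstar|)).mono'
    (hF.continuous.comp_aestronglyMeasurable hX.1) (ae_of_all _ fun ω => ?_)
  have h1 := le_quadratic_of_lipschitz_gradient hF hL 0 (X ω)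
  rw [zero_add] at h1
  have h2 := hs (X ω)
  rw [Real.norm_eq_abs, Pi.add_apply, Real.norm_eq_abs]
  set q := F 0 + inner ℝ (gradient F 0) (X ω) + L / 2 * ‖X ω‖ ^ 2
  have h3 := neg_abs_le (F wstar)
  have h4 := abs_nonneg (F wstar)
  have h5 := le_abs_self q
  have h6 := abs_nonneg q
  exact abs_le.2 ⟨by linarith, by linarith⟩

theorem IsSGD.condExp_eq (hW : IsSGD R pol W) (hR : R.Admissible c μ ν ℱ)
    (hF : Differentiable ℝ R.F)
    (hL : ∀ w w' : Vec d, ‖gradient R.F w - gradient R.F w'‖ ≤ L * ‖w - w'‖)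
    (hs : ∀ w, R.F wstar ≤ R.F w) (k : ℕ) :
    μ[fun ω => R.F (W (k + 1) ω) | ℱ k] =ᵐ[μ] fun ω => ∫ ω', R.F (W k ω
      - R.η k • eeGradient (pol k) (R.table k (W k ω) fun p => R.seed k p ω') R.T) ∂μ := by
  have hg := continuous_gradient hL
  have hi : Integrable (fun ω => R.F (W (k + 1) ω)) μ :=
    integrable_comp_of_memLp hF hL hs (hW.memLp hR hL (k + 1))
  simp only [hW.succ k] at hi ⊢
  exact condExp_comp_prodMk_of_indep (ℱ.le k) (hW.measurable hR hg k) (measurable_seeds hR k)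
    (hR.seed_indep_past k) (f := fun z : Vec d × (ℕ × ℕ × ℕ → Ξ) => R.F (R.step k (pol k) z.1 z.2))
    (hF.continuous.measurable.comp (measurable_step hR hg k (hW.measurable_pol k))) hi

end Iterates

/-! ### The excess term -/

section Excess

variable {d : ℕ} {Ω Ξ : Type*} {R : Run d Ω Ξ} {c : ℝ}

theorem excess_eq (c : ℝ) (T k : ℕ) (w : Vec d) :
    R.excess c T k w
      = R.C₁ c k w * Real.log T / (T : ℝ) ^ 2 + R.C₂ k / (T : ℝ) ^ 2 := by
  unfold excess Z
  ring

theorem τ_eq (c m L : ℝ) (k : ℕ) (w : Vec d) :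
    R.τ c m L k w
      = m * L * R.η k ^ 2 * (1 + R.Z c R.T k w) - 2 * m * R.η k + 1 := by
  unfold τ τopt excess
  ring

theorem rate_nonneg {c : ℝ} (hc : 0 ≤ c) (d : ℕ) (b p : ℝ) {ε : ℝ} (hε : 0 ≤ ε) :
    0 ≤ rate c d b p ε := by
  unfold rate
  rcases le_total 0 (b * p) with h | h
  · positivity
  · refine mul_nonneg_of_nonpos_of_nonpos (div_nonpos_of_nonneg_of_nonpos (by positivity) h) ?_
    exact (min_le_right _ _).trans (div_nonpos_of_nonneg_of_nonpos (by positivity) h)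

theorem C₁_nonneg (hc : 0 ≤ c) (hα : 0 ≤ R.α) (k : ℕ) (w : Vec d) : 0 ≤ R.C₁ c k w := by
  refine Finset.sum_nonneg fun n hn => ?_
  have h1 := (Finset.mem_filter.1 hn).2
  have h2 : 0 ≤ noiseTrace R.F w := by rw [noiseTrace_eq]; positivity
  exact div_nonneg (mul_nonneg hα h1.le) (rate_nonneg hc _ _ _ (by positivity))

theorem Δ_nonneg {k : ℕ} (ho : (R.oracle k).IsOptimal (R.nStar k)) {n : ℕ}
    (hn : n ∈ Finset.Icc 1 (R.oracle k).N) : 0 ≤ R.Δ k n :=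
  sub_nonneg.2 (ho.2 n hn)

theorem C₂_nonneg {k : ℕ} (ho : (R.oracle k).IsOptimal (R.nStar k)) (hα : 2 < R.α) :
    0 ≤ R.C₂ k :=
  mul_nonneg (Finset.sum_nonneg fun _ hn => Δ_nonneg ho hn)
    (div_nonneg (by linarith) (by linarith))

theorem C₂_pos {k : ℕ} (ho : (R.oracle k).IsOptimal (R.nStar k)) (hα : 2 < R.α)
    (h : ∃ n ∈ Finset.Icc 1 (R.oracle k).N, 0 < R.Δ k n) : 0 < R.C₂ k :=
  mul_pos (Finset.sum_pos' (fun _ hn => Δ_nonneg ho hn) h) (div_pos (by linarith) (by linarith))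

theorem tendsto_excess (c : ℝ) (k : ℕ) (w : Vec d) :
    Tendsto (fun T : ℕ => R.excess c T k w) atTop (𝓝 0) := by
  have h1 : Tendsto (fun x : ℝ => Real.log x / x ^ 2) atTop (𝓝 0) := by
    have := (isLittleO_log_rpow_atTop (r := 2) (by norm_num)).tendsto_div_nhds_zero
    simpa using this
  have h2 : Tendsto (fun x : ℝ => (x ^ 2)⁻¹) atTop (𝓝 0) :=
    (tendsto_pow_atTop two_ne_zero).inv_tendsto_atTop
  have h3 := ((h1.const_mul (R.C₁ c k w)).add (h2.const_mul (R.C₂ k))).comp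
    tendsto_natCast_atTop_atTop
  rw [mul_zero, mul_zero, add_zero] at h3
  refine h3.congr fun T => ?_
  rw [excess_eq, Function.comp]
  ring

theorem measurable_τ (hg : Continuous (gradient R.F)) (c m L : ℝ) (k : ℕ) :
    Measurable fun w => R.τ c m L k w := by
  have hn : Measurable fun w => noiseTrace R.F w := by
    simp only [noiseTrace_eq]
    exact (hg.norm.pow 2).measurable
  have hr : ∀ b p : ℝ, Measurable fun ε => rate c d b p ε := fun b p => by
    unfold rate
    exact ((measurable_id.const_mul c).div_const _).mul
      (measurable_const.min ((measurable_id.div_const _).div_const _))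
  have hC : Measurable fun w => R.C₁ c k w :=
    Finset.measurable_sum _ fun n _ => measurable_const.div
      ((hr _ _).comp ((hn.const_mul _).div_const 2))
  simp only [τ_eq, Z]
  fun_prop

end Excess

end Run

end EEGrad

/-- Contraction of the expected optimality gaps of the optimal mini-batch SGD algorithm and of
SGD with EE-Grad for strongly convex objectives. -/
theorem theorem2 :
    -- the universal constant in the selection rule of EE-Grad
    ∃ c : ℝ, 0 < c ∧
    ∀ {d : ℕ} [NeZero d] {Ω Ξ : Type*} [MeasurableSpace Ω] [MeasurableSpace Ξ]
      (μ : Measure Ω) [IsProbabilityMeasure μ] (ν : Measure Ξ) [IsProbabilityMeasure ν]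
      (ℱ : Filtration ℕ (inferInstance : MeasurableSpace Ω))
      (R : Run d Ω Ξ) (wstar : Vec d) (m L : ℝ),
      0 < m → 0 < L →
      Differentiable ℝ R.F →
      (∀ w w' : Vec d, ‖gradient R.F w - gradient R.F w'‖ ≤ L * ‖w - w'‖) →
      (∀ w w' : Vec d,
        R.F w' ≥ R.F w + inner ℝ (gradient R.F w) (w' - w) + 1 / 2 * m * ‖w' - w‖ ^ 2) →
      (∀ w : Vec d, R.F wstar ≤ R.F w) →
      R.Admissible c μ ν ℱ →
      ∀ k : ℕ, 0 < R.η k →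
        -- the expected gaps are well defined
        (∀ k', Integrable (fun ω => R.F (R.iter k' ω)) μ ∧
          Integrable (fun ω => R.F (R.optIter k' ω)) μ) ∧
        -- the excess term
        (∀ w : Vec d,
          (∀ T : ℕ, R.excess c T k w
            = R.C₁ c k w * Real.log T / (T : ℝ) ^ 2 + R.C₂ k / (T : ℝ) ^ 2) ∧
          0 ≤ R.excess c R.T k w ∧
          ((∃ n ∈ Finset.Icc 1 (R.oracle k).N, 0 < R.Δ k n) → 0 < R.excess c R.T k w) ∧
          Tendsto (fun T : ℕ => R.excess c T k w) atTop (𝓝 0)) ∧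
        -- optimal mini-batch SGD; it is enough that the step size condition holds at some point
        ((∃ w : Vec d, R.η k < 2 / (L * (1 + R.Z c R.T k w))) →
          0 < R.τopt m L k ∧ R.τopt m L k < 1 ∧
          (∀ᵐ ω ∂μ, (μ[fun ω => R.F (R.optIter (k + 1) ω) | ℱ k]) ω - R.F wstar
            ≤ R.τopt m L k * (R.F (R.optIter k ω) - R.F wstar)) ∧
          R.Jopt μ wstar (k + 1) ≤ R.τopt m L k * R.Jopt μ wstar k) ∧
        -- EE-Grad, conditionally on the past of iteration `k`
        (∀ᵐ ω ∂μ, noiseTrace R.F (R.iter k ω) ≤ R.P k →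
          R.η k < 2 / (L * (1 + R.Z c R.T k (R.iter k ω))) →
          0 < R.τ c m L k (R.iter k ω) ∧ R.τ c m L k (R.iter k ω) < 1 ∧
          (μ[fun ω => R.F (R.iter (k + 1) ω) | ℱ k]) ω - R.F wstar
            ≤ R.τ c m L k (R.iter k ω) * (R.F (R.iter k ω) - R.F wstar)) ∧
        -- EE-Grad, in expectation
        ((∀ᵐ ω ∂μ, noiseTrace R.F (R.iter k ω) ≤ R.P k) →
          (∀ᵐ ω ∂μ, R.η k < 2 / (L * (1 + R.Z c R.T k (R.iter k ω)))) →
          R.J μ wstar (k + 1)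
            ≤ ∫ ω, R.τ c m L k (R.iter k ω) * (R.F (R.iter k ω) - R.F wstar) ∂μ ∧
          ∀ τ' : ℝ, (∀ᵐ ω ∂μ, R.τ c m L k (R.iter k ω) ≤ τ') →
            R.J μ wstar (k + 1) ≤ τ' * R.J μ wstar k) := by
  refine ⟨selC, selC_pos, ?_⟩
  intro d _ Ω Ξ _ _ μ _ ν _ ℱ R wstar m L hm hL0 hF hL hc hs hR k hη
  have hg := continuous_gradient hL
  have hd : 0 < d := Nat.pos_of_ne_zero (NeZero.ne d)
  have hmL : m ≤ L := strong_convexity_le_lipschitz hF hL hc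
  have hT : (0 : ℝ) < R.T := by exact_mod_cast hR.T_pos
  have hT1 : (1 : ℝ) ≤ R.T := by exact_mod_cast hR.T_pos
  have hlog : 0 ≤ Real.log R.T := Real.log_nonneg hT1
  have hα := hR.two_lt_α
  have ho := hR.isOptimal k
  have hE := Run.isSGD_iter hR
  have hO := Run.isSGD_optIter hR
  have hiE : ∀ k', Integrable (fun ω => R.F (R.iter k' ω)) μ := fun k' =>
    Run.integrable_comp_of_memLp hF hL hs (hE.memLp hR hL k')
  have hiO : ∀ k', Integrable (fun ω => R.F (R.optIter k' ω)) μ := fun k' =>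
    Run.integrable_comp_of_memLp hF hL hs (hO.memLp hR hL k')
  have hσ : 0 < R.sigmaStarSq k := (R.oracle k).sigmaSq_pos ho.1
  have hσT : 0 < R.sigmaStarSq k / R.T := div_pos hσ hT
  have hC₁ : ∀ w, 0 ≤ R.C₁ selC k w := Run.C₁_nonneg selC_pos.le (by linarith) k
  have hC₂ := Run.C₂_nonneg ho hα
  have hex : ∀ w, 0 ≤ R.excess selC R.T k w := fun w => by
    have := hC₁ w
    rw [Run.excess_eq]
    positivity
  have hZ : ∀ w, R.sigmaStarSq k / R.T ≤ R.Z selC R.T k w := fun w => sub_nonneg.1 (hex w)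
  have hZ0 : ∀ w, 0 < R.Z selC R.T k w := fun w => hσT.trans_le (hZ w)
  have key : ∀ᵐ ω ∂μ, noiseTrace R.F (R.iter k ω) ≤ R.P k →
      R.η k < 2 / (L * (1 + R.Z selC R.T k (R.iter k ω))) →
      0 < R.τ selC m L k (R.iter k ω) ∧ R.τ selC m L k (R.iter k ω) < 1 ∧
      (μ[fun ω => R.F (R.iter (k + 1) ω) | ℱ k]) ω - R.F wstar
        ≤ R.τ selC m L k (R.iter k ω) * (R.F (R.iter k ω) - R.F wstar) := by
    filter_upwards [hE.condExp_eq hR hF hL hs k] with ω hω hSP hηZ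
    rw [hω, Run.τ_eq]
    set w := R.iter k ω
    obtain ⟨h1, h2⟩ := contraction_factor_mem hm hmL hη (hZ0 w) hηZ
    refine ⟨h1, h2, ?_⟩
    have hmom := hE.moments_eeGradient hR hg k w
    refine expected_descent hm hL0 hF hL hc hs hη (hZ0 w).le hηZ hmom.1 hmom.2.1 ?_
    have hS : 0 ≤ noiseTrace R.F w := by rw [noiseTrace_eq]; positivity
    have h3 := (Run.isSubGaussianTable hR hg k w).integral_norm_sq_eeGradient_le hd (hR.policy k) hα
      hS hSP (fun n hn => (R.oracle k).sigmaSq_pos hn) (hR.le_β k)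
      (fun n hn => Run.sum_varianceProxy k w hn) ho.1 ho.2 hR.T_pos
    have h4 : (1 + R.Z selC R.T k w) * ‖gradient R.F w‖ ^ 2
        = ‖gradient R.F w‖ ^ 2 + noiseTrace R.F w * R.Z selC R.T k w := by
      rw [noiseTrace_eq]
      ring
    exact h3.trans_eq h4.symm
  refine ⟨fun k' => ⟨hiE k', hiO k'⟩, fun w => ⟨fun T => Run.excess_eq _ _ _ _, hex w, fun h => ?_,
    Run.tendsto_excess _ _ _⟩, ?_, key, ?_⟩
  · have h1 := hC₁ w
    have h2 := Run.C₂_pos ho hα h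
    rw [Run.excess_eq]
    positivity
  · rintro ⟨w, hw⟩
    -- `Z_T(w) ≥ σ_*² / T` at every `w`, so the condition at one point gives it for `σ_*² / T`
    have hησ : R.η k < 2 / (L * (1 + R.sigmaStarSq k / R.T)) := by
      refine hw.trans_le ?_
      have := hZ w
      gcongr
    obtain ⟨h1, h2⟩ := contraction_factor_mem hm hmL hη hσT hησ
    have h1' : 0 < R.τopt m L k := h1
    have hae : ∀ᵐ ω ∂μ, (μ[fun ω => R.F (R.optIter (k + 1) ω) | ℱ k]) ω - R.F wstar
        ≤ R.τopt m L k * (R.F (R.optIter k ω) - R.F wstar) := by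
      filter_upwards [hO.condExp_eq hR hF hL hs k] with ω hω
      rw [hω]
      set w := R.optIter k ω
      have hmom := hO.moments_eeGradient hR hg k w
      refine expected_descent hm hL0 hF hL hc hs hη hσT.le hησ hmom.1 hmom.2.1 (le_of_eq ?_)
      rw [((Run.isSubGaussianTable hR hg k w).moments_eeGradient (hO.mem k) (hO.measurable_pol k)
        (fun n hn => Run.sum_varianceProxy k w hn) hR.T_pos).2.2,
        Finset.sum_eq_single_of_mem (R.nStar k) ho.1 fun n _ hn => ?_]
      · simp only [count_const, integral_const, probReal_univ, one_smul, noiseTrace_eq]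
        rw [Run.sigmaStarSq]
        field_simp
      · have h0 : ∀ x : ℕ → ℕ → Vec d, count (fun _ => R.nStar k) x R.T n = 0 := fun x => by
          rw [count_eq_sum]
          exact Finset.sum_eq_zero fun j _ => if_neg fun h => hn h.symm
        simp [h0]
    refine ⟨h1', h2, hae, ?_⟩
    have h3 := integral_mono_ae (integrable_condExp.sub (integrable_const _))
      (((hiO k).sub (integrable_const _)).const_mul _) hae
    simp only [Pi.sub_apply] at h3
    rw [integral_sub integrable_condExp (integrable_const _), integral_condExp (ℱ.le k),
      integral_const_mul, integral_sub (hiO k) (integrable_const _)] at h3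
    simpa [Run.Jopt] using h3
  · intro hSP hηZ
    have hgap : Integrable (fun ω => R.F (R.iter k ω) - R.F wstar) μ :=
      (hiE k).sub (integrable_const _)
    have hτi : Integrable
        (fun ω => R.τ selC m L k (R.iter k ω) * (R.F (R.iter k ω) - R.F wstar)) μ := by
      have hWm := (hE.measurable hR hg k).mono (ℱ.le k) le_rfl
      refine hgap.mono' (((Run.measurable_τ hg selC m L k).comp hWm).aestronglyMeasurable.mul
        hgap.1) ?_
      filter_upwards [key, hSP, hηZ] with ω h1 h2 h3
      obtain ⟨h4, h5, -⟩ := h1 h2 h3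
      have h6 : 0 ≤ R.F (R.iter k ω) - R.F wstar := sub_nonneg.2 (hs _)
      rw [Real.norm_of_nonneg (mul_nonneg h4.le h6)]
      nlinarith
    have hJ : R.J μ wstar (k + 1)
        ≤ ∫ ω, R.τ selC m L k (R.iter k ω) * (R.F (R.iter k ω) - R.F wstar) ∂μ := by
      have h3 := integral_mono_ae (integrable_condExp.sub (integrable_const (R.F wstar))) hτi
        (by filter_upwards [key, hSP, hηZ] with ω h1 h2 h3 using (h1 h2 h3).2.2)
      simp only [Pi.sub_apply] at h3
      rw [integral_sub integrable_condExp (integrable_const _), integral_condExp (ℱ.le k)] at h3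
      simpa [Run.J] using h3
    refine ⟨hJ, fun τ' hτ' => hJ.trans ?_⟩
    have h4 := integral_mono_ae hτi (hgap.const_mul τ')
      (by filter_upwards [hτ'] with ω h1 using
        mul_le_mul_of_nonneg_right h1 (sub_nonneg.2 (hs _)))
    rw [integral_const_mul, integral_sub (hiE k) (integrable_const _)] at h4
    simpa [Run.J] using h4
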